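/- Let $C^\infty([0,\infty))$ (complex valued, smooth up to $0$) carry the topology of uniform convergence of all derivatives on compact sets, and $C^\infty_c([0,\infty))$ (compactly supported functions) the inductive limit topology of the subspaces of functions supported in $[0,N]$, $N\in\mathbb N$. Let $\mathcal A$ be a complex Fréchet space such that: (1) $C^\infty_c([0,\infty))\subset\mathcal A\subset C^\infty([0,\infty))$ with continuous embeddings; put $\mathcal A_0=\{f\in\mathcal A : \operatorname{supp} f\subset(0,\infty)\}$; (2) $f\in\mathcal A$ implies $f'\in\mathcal A$; (3) there is given a non-zero linear functional (``regularized integral'') $\rho:\mathcal A\to\mathbb C$ such that (a) for some $\lambda\in\mathbb C$, $\rho(f)=\lambda\int_0^\infty f(x)\,dx$ for all $f\in C^\infty_c([0,\infty))$; (b) $\rho(f')=0$ for all $f\in\mathcal A_0$; (c) if $f\in\mathcal A_0$ and $\rho(f)=0$, then $F(r)=\int_0^r f(s)\,ds$ belongs to $\mathcal A$. Let $M$ be a compact smooth manifold without boundary, of dimension $n$ (for instance an oriented one; no orientation is needed). Let $\Omega^k\mathcal A_0([0,\infty)\times M)$ be the space of smooth complex $k$-forms on the manifold with boundary $[0,\infty)\times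 M$ which vanish on $[0,\varepsilon)\times M$ for some $\varepsilon>0$ and whose coefficients $f(r,x)$ in the local coordinates given by a chart $U$ of $M$ are such that $x\mapsto f(\cdot,x)$ is a smooth map from $U$ to the Fréchet space $\mathcal A$. Let $\pi_*$ be integration along the fiber: for vectors $v_1,\dots,v_{k-1}$ tangent to $M$ at $p$, $$(\pi_*\omega)_p(v_1,\dots,v_{k-1})=\rho\bigl(r\mapsto\omega_{(r,p)}(v_1,\dots,v_{k-1},\partial_r)\bigr),$$ so that $\pi_*(f_1\,\pi^*\eta_1+f_2\,\pi^*\eta_2\wedge dr)=\rho(f_2)\,\eta_2$, $\rho$ being applied in the variable $r$; in degree $0$, $\pi_*=0$. Then the exterior derivative maps $\Omega^k\mathcal A_0([0,\infty)\times M)$ to $\Omega^{k+1}\mathcal A_0([0,\infty)\times M)$, $\pi_*$ maps $\Omega^k\mathcal A_0([0,\infty)\times M)$ to $\Omega^{k-1}(M)$ and commutes with the exterior derivatives, and $\pi_*$ induces isomorphisms $$H^k\mathcal A_0([0,\infty)\times M)\longrightarrow H^{k-1}_{\mathrm{dR}}(M),\qquad [\omega]\mapsto[\pi_*\omega],$$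 for all $k\ge 0$, where $H^k\mathcal A_0([0,\infty)\times M)$ is the cohomology of the complex $(\Omega^\bullet\mathcal A_0([0,\infty)\times M),d)$ and $H^\bullet_{\mathrm{dR}}(M)$ is de Rham cohomology with complex coefficients; for $k=0$ this means $H^0\mathcal A_0([0,\infty)\times M)=0$. -/

import Mathlib

open Set Filter Topology MeasureTheory
open scoped Manifold ContDiff

noncomputable section

namespace ConeThom

/-! ## The half line `[0,∞)` and smooth functions on it -/

/-- The half line `[0,∞)`. -/
abbrev HalfLine : Type := Set.Ici (0 : ℝ)

/-- The half line as a model with corners (with tangent space `ℝ`); through it `[0,∞)` is a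
one-dimensional smooth manifold with boundary. -/
def halfLineModel : ModelWithCorners ℝ ℝ HalfLine where
  toFun := Subtype.val
  invFun := Set.projIci 0
  source := univ
  target := Set.Ici 0
  map_source' x _ := x.2
  map_target' _ _ := mem_univ _
  left_inv' x _ := Set.projIci_coe x
  right_inv' x hx := by simp [Set.coe_projIci, max_eq_right (show (0 : ℝ) ≤ x from hx)]
  source_eq := rfl
  convex_range' := by
    have h : range (Subtype.val : HalfLine → ℝ) = Set.Ici 0 := Subtype.range_coe
    have hc : Convex ℝ (range (Subtype.val : HalfLine → ℝ)) := by
      rw [h]; exact convex_Ici 0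
    simp only [instIsRCLikeNormedField, ↓reduceDIte]
    exact Convex.convex_isRCLikeNormedField hc
  nonempty_interior' := by
    have h : range (Subtype.val : HalfLine → ℝ) = Set.Ici 0 := Subtype.range_coe
    change (interior (range (Subtype.val : HalfLine → ℝ))).Nonempty
    rw [h, interior_Ici]
    exact ⟨1, one_pos (α := ℝ)⟩
  continuous_toFun := continuous_subtype_val
  continuous_invFun := (continuous_const.max continuous_id).subtype_mk _

/-- `C^∞([0,∞))`: complex functions on `[0,∞)`, smooth up to and including `0`. -/
def smoothFunctions : Submodule ℂ (HalfLine → ℂ) where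
  carrier := {f | ContDiffOn ℝ ∞ (Set.IciExtend f) (Set.Ici 0)}
  zero_mem' := (contDiff_const (c := (0 : ℂ))).contDiffOn
  add_mem' hf hg := ContDiffOn.add hf hg
  smul_mem' c _ hf := ContDiffOn.const_smul c hf

/-- The derivative `f'` on `[0,∞)` (one-sided at `0`). -/
def halfDeriv (f : HalfLine → ℂ) : HalfLine → ℂ :=
  fun r ↦ derivWithin (Set.IciExtend f) (Set.Ici 0) r

/-- The topology of uniform convergence of all derivatives on compact subsets of `[0,∞)`.
It is only ever used on smooth functions. -/
@[reducible] def smoothTopology : TopologicalSpace (HalfLine → ℂ) :=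
  ⨅ j : ℕ, TopologicalSpace.induced
    (fun f ↦ UniformOnFun.ofFun {K : Set HalfLine | IsCompact K} (halfDeriv^[j] f)) inferInstance

/-- The space of smooth functions on `[0,∞)` with support in `[0,N]`. -/
def testFunctions (N : ℕ) : Set (HalfLine → ℂ) :=
  {f | f ∈ smoothFunctions ∧ ∀ r : HalfLine, (N : ℝ) < r → f r = 0}

/-- `supp f ⊂ (0,∞)`, i.e. `f` vanishes in a neighbourhood of `0`. -/
def VanishesNearZero (f : HalfLine → ℂ) : Prop :=
  ∃ ε : ℝ, 0 < ε ∧ ∀ r : HalfLine, (r : ℝ) < ε → f r = 0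

/-! ## The coefficient spaces -/

/-- A (Fréchet) space `𝒜` with `C_c^∞([0,∞)) ⊂ 𝒜 ⊂ C^∞([0,∞))` (continuous embeddings), closed
under differentiation, together with a nontrivial regularized integral on it.
The space `𝒜` is given as a type `F` with an injective linear map `incl` to functions on
`[0,∞)`, and is identified with the image of `incl`. That `F` is a Fréchet space is expressed by
type classes on `F` where this structure is used. -/
structure CoefficientSpace (F : Type*) [AddCommGroup F] [Module ℂ F] [TopologicalSpace F] where
  /-- the inclusion of `𝒜` into the functions on `[0,∞)` -/
  incl : F →ₗ[ℂ] (HalfLine → ℂ)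
  incl_injective : Function.Injective incl
  /-- `𝒜 ⊂ C^∞([0,∞))` -/
  incl_mem : ∀ a, incl a ∈ smoothFunctions
  /-- the embedding `𝒜 ⊂ C^∞([0,∞))` is continuous -/
  continuous_incl : Continuous[inferInstance, smoothTopology] incl
  /-- `C_c^∞([0,∞)) ⊂ 𝒜`, and this embedding is continuous for the inductive limit topology,
  i.e. it is continuous on the functions supported in `[0,N]`, for all `N` -/
  test_embedding : ∀ N : ℕ, ∃ j : testFunctions N → F, (∀ f, incl (j f) = f) ∧
    Continuous[smoothTopology.induced Subtype.val, inferInstance] j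
  /-- `𝒜` is closed under differentiation -/
  deriv_mem : ∀ a, ∃ b, incl b = halfDeriv (incl a)
  /-- the regularized integral -/
  reg : F →ₗ[ℂ] ℂ
  reg_ne_zero : reg ≠ 0
  /-- on compactly supported functions `reg` is a multiple of the integral -/
  reg_test : ∃ c : ℂ, ∀ a, HasCompactSupport (incl a) →
    reg a = c * ∫ r in Set.Ioi (0 : ℝ), Set.IciExtend (incl a) r
  /-- `reg` is closed: it vanishes on derivatives of functions in `𝒜₀` -/
  reg_deriv : ∀ a b, VanishesNearZero (incl a) → incl b = halfDeriv (incl a) → reg b = 0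
  /-- the primitive of a function in `𝒜₀` with vanishing regularized integral is in `𝒜` -/
  primitive_mem : ∀ a, VanishesNearZero (incl a) → reg a = 0 →
    ∃ b, ∀ r : HalfLine, incl b r = ∫ s in (0 : ℝ)..r, Set.IciExtend (incl a) s

/-- The regularized integral as a functional on the space of functions `𝒜 ⊂ C^∞([0,∞))`. -/
def CoefficientSpace.integral {F : Type*} [AddCommGroup F] [Module ℂ F] [TopologicalSpace F]
    (A : CoefficientSpace F) : LinearMap.range A.incl →ₗ[ℂ] ℂ :=
  A.reg ∘ₗ (LinearEquiv.ofInjective A.incl A.incl_injective).symm.toLinearMap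

/-- `g` is of class `C^m` on the open set `U` of a finite-dimensional space, with values in a
topological vector space: all iterated directional derivatives up to order `m` exist and are
continuous on `U`. -/
def IsCkOn {E F : Type*} [AddCommGroup E] [Module ℝ E] [TopologicalSpace E]
    [AddCommGroup F] [Module ℝ F] [TopologicalSpace F] (U : Set E) : ℕ → (E → F) → Prop
  | 0, g => ContinuousOn g U
  | m + 1, g => ContinuousOn g U ∧ ∀ v : E, ∃ g' : E → F,
      (∀ x ∈ U, Tendsto (fun t : ℝ ↦ t⁻¹ • (g (x + t • v) - g x)) (𝓝[≠] 0) (𝓝 (g' x))) ∧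
        IsCkOn U m g'

/-- `g` is smooth on the open set `U`, with values in a topological vector space. -/
def IsSmoothOn {E F : Type*} [AddCommGroup E] [Module ℝ E] [TopologicalSpace E]
    [AddCommGroup F] [Module ℝ F] [TopologicalSpace F] (U : Set E) (g : E → F) : Prop :=
  ∀ m : ℕ, IsCkOn U m g

theorem IsCkOn.add {E F : Type*} [AddCommGroup E] [Module ℝ E] [TopologicalSpace E]
    [AddCommGroup F] [Module ℝ F] [TopologicalSpace F] [ContinuousAdd F] {U : Set E} {m : ℕ} :
    ∀ {g h : E → F}, IsCkOn U m g → IsCkOn U m h → IsCkOn U m (g + h) := by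
  induction m with
  | zero => exact fun hg hh ↦ ContinuousOn.add hg hh
  | succ m ih =>
    intro g h hg hh
    refine ⟨hg.1.add hh.1, fun v ↦ ?_⟩
    obtain ⟨g', hg', hgm⟩ := hg.2 v
    obtain ⟨h', hh', hhm⟩ := hh.2 v
    refine ⟨g' + h', fun x hx ↦ ?_, ih hgm hhm⟩
    refine ((hg' x hx).add (hh' x hx)).congr fun t ↦ ?_
    simp only [Pi.add_apply, ← smul_add]
    congr 1
    abel

theorem IsCkOn.const_smul {E F : Type*} [AddCommGroup E] [Module ℝ E] [TopologicalSpace E]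
    [AddCommGroup F] [Module ℂ F] [TopologicalSpace F] [ContinuousSMul ℂ F] {U : Set E} (c : ℂ)
    {m : ℕ} : ∀ {g : E → F}, IsCkOn U m g → IsCkOn U m (c • g) := by
  induction m with
  | zero => exact fun hg ↦ ContinuousOn.const_smul hg c
  | succ m ih =>
    intro g hg
    refine ⟨hg.1.const_smul c, fun v ↦ ?_⟩
    obtain ⟨g', hg', hgm⟩ := hg.2 v
    refine ⟨c • g', fun x hx ↦ ?_, ih hgm⟩
    refine ((hg' x hx).const_smul c).congr fun t ↦ ?_
    simp only [Pi.smul_apply, ← smul_sub]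
    exact smul_comm _ _ _

theorem IsCkOn.zero {E F : Type*} [AddCommGroup E] [Module ℝ E] [TopologicalSpace E]
    [AddCommGroup F] [Module ℝ F] [TopologicalSpace F] {U : Set E} {m : ℕ} :
    IsCkOn U m (0 : E → F) := by
  induction m with
  | zero => exact continuousOn_const
  | succ m ih => exact ⟨continuousOn_const, fun v ↦ ⟨0, fun x _ ↦ by simpa using! tendsto_const_nhds, ih⟩⟩

/-! ## Complex differential forms on a manifold and their cohomology -/

section Forms

variable {E : Type*} [NormedAddCommGroup E] [NormedSpace ℝ E] {H : Type*} [TopologicalSpace H]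
  (I : ModelWithCorners ℝ E H) {M : Type*} [TopologicalSpace M] [ChartedSpace H M]

/-- Complex valued `k`-forms on `M`, with no regularity assumption. -/
def FormField (M : Type*) [TopologicalSpace M] [ChartedSpace H M] (k : ℕ) : Type _ :=
  (x : M) → (TangentSpace I x) [⋀^Fin k]→L[ℝ] ℂ

instance (k : ℕ) : AddCommGroup (FormField I M k) :=
  inferInstanceAs (AddCommGroup ((x : M) → (TangentSpace I x) [⋀^Fin k]→L[ℝ] ℂ))

instance (k : ℕ) : Module ℂ (FormField I M k) :=
  inferInstanceAs (Module ℂ ((x : M) → (TangentSpace I x) [⋀^Fin k]→L[ℝ] ℂ))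

/-- The coordinate expression of the form `θ` in the chart at `x₀`: its pullback under the
inverse of the chart. -/
def localRep {k : ℕ} (θ : FormField I M k) (x₀ : M) : E → E [⋀^Fin k]→L[ℝ] ℂ := fun y ↦
  (θ ((extChartAt I x₀).symm y)).compContinuousLinearMap
    (mfderivWithin 𝓘(ℝ, E) I (extChartAt I x₀).symm (range I) y)

variable (M) in
/-- `Ω^k(M)`: smooth complex valued `k`-forms. -/
def smoothForms (k : ℕ) : Submodule ℂ (FormField I M k) where
  carrier := {θ | ∀ x₀ : M, ContDiffOn ℝ ∞ (localRep I θ x₀) (extChartAt I x₀).target}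
  zero_mem' _ := (contDiff_const (c := (0 : E [⋀^Fin k]→L[ℝ] ℂ))).contDiffOn
  add_mem' hθ hη x₀ := ContDiffOn.add (hθ x₀) (hη x₀)
  smul_mem' c _ hθ x₀ := ContDiffOn.const_smul c (hθ x₀)

/-- The exterior derivative of a form on a manifold, computed at `x` in the chart at `x`. -/
def extD {k : ℕ} (θ : FormField I M k) : FormField I M (k + 1) := fun x ↦
  (extDerivWithin (localRep I θ x) (range I) (extChartAt I x x)).compContinuousLinearMap
    (mfderiv I 𝓘(ℝ, E) (extChartAt I x) x)

theorem differentiableWithinAt_localRep {k : ℕ} {θ : FormField I M k}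
    (hθ : θ ∈ smoothForms I M k) (x : M) :
    DifferentiableWithinAt ℝ (localRep I θ x) (range I) (extChartAt I x x) :=
  (((hθ x) _ (mem_extChartAt_target x)).differentiableWithinAt (by simp)).mono_of_mem_nhdsWithin
    (extChartAt_target_mem_nhdsWithin x)

theorem localRep_self [IsManifold I 1 M] {k : ℕ} (θ : FormField I M k) (x : M) (w : Fin k → E) :
    localRep I θ x (extChartAt I x x) w = θ x w := by
  have key : ∀ z : M, z = x → ∀ w : Fin k → E,
      (show E [⋀^Fin k]→L[ℝ] ℂ from θ z) w = (show E [⋀^Fin k]→L[ℝ] ℂ from θ x) w := by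
    rintro z rfl w
    rfl
  refine Eq.trans ?_ (key _ ((extChartAt I x).left_inv (mem_extChartAt_source x)) w)
  have h := mfderivWithin_range_extChartAt_symm (I := I) (x := x)
  exact congrArg (θ ((extChartAt I x).symm (extChartAt I x x)))
    (funext fun i ↦ DFunLike.congr_fun h (w i))

variable (M) in
/-- The exterior derivative as a linear map on smooth forms. -/
def extDLinear (k : ℕ) : smoothForms I M k →ₗ[ℂ] FormField I M (k + 1) where
  toFun θ := extD I θ.1
  map_add' θ η := by
    funext x
    have hu : UniqueDiffWithinAt ℝ (range I) (extChartAt I x x) :=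
      I.uniqueDiffOn _ (mem_range_self _)
    have h := extDerivWithin_add hu
      (differentiableWithinAt_localRep I θ.2 x) (differentiableWithinAt_localRep I η.2 x)
    exact congrArg (fun α : E [⋀^Fin (k + 1)]→L[ℝ] ℂ ↦ (α.compContinuousLinearMap
      (mfderiv I 𝓘(ℝ, E) (extChartAt I x) x) : TangentSpace I x [⋀^Fin (k + 1)]→L[ℝ] ℂ)) h
  map_smul' c θ := by
    funext x
    have hu : UniqueDiffWithinAt ℝ (range I) (extChartAt I x x) :=
      I.uniqueDiffOn _ (mem_range_self _)
    have h : extDerivWithin (c • localRep I θ.1 x) (range I) (extChartAt I x x)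
        = c • extDerivWithin (localRep I θ.1 x) (range I) (extChartAt I x x) := by
      rw [extDerivWithin, extDerivWithin,
        fderivWithin_const_smul hu (differentiableWithinAt_localRep I θ.2 x) c]
      exact ContinuousAlternatingMap.alternatizeUncurryFin_smul _ _
    exact congrArg (fun α : E [⋀^Fin (k + 1)]→L[ℝ] ℂ ↦ (α.compContinuousLinearMap
      (mfderiv I 𝓘(ℝ, E) (extChartAt I x) x) : TangentSpace I x [⋀^Fin (k + 1)]→L[ℝ] ℂ)) h

variable {I}

/-- The closed forms among the `k`-forms in `Ω k`. -/
def closedForms (Ω : ∀ k, Submodule ℂ (FormField I M k)) (k : ℕ) :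
    Submodule ℂ (FormField I M k) :=
  Ω k ⊓ (LinearMap.ker (extDLinear I M k)).map (smoothForms I M k).subtype

/-- The exact forms `{dη | η ∈ Ω (k - 1)}`; only `0` in degree `0`. -/
def exactForms (Ω : ∀ k, Submodule ℂ (FormField I M k)) :
    ∀ k, Submodule ℂ (FormField I M k)
  | 0 => ⊥
  | k + 1 => ((Ω k).comap (smoothForms I M k).subtype).map (extDLinear I M k)

/-- The `k`-th cohomology of the complex `(Ω, d)` of smooth forms: closed modulo exact forms. -/
abbrev Cohomology (Ω : ∀ k, Submodule ℂ (FormField I M k)) (k : ℕ) : Type _ :=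
  closedForms Ω k ⧸ (exactForms Ω k).submoduleOf (closedForms Ω k)

end Forms

/-! ## Forms on the cone and integration along the fiber -/

section Cone

variable {n : ℕ} {M : Type*} [TopologicalSpace M] [ChartedSpace (EuclideanSpace ℝ (Fin n)) M]
  {F : Type*} [AddCommGroup F] [Module ℂ F] [TopologicalSpace F]

variable (n) in
/-- The model of the manifold with boundary `[0,∞) × M`. Tangent vectors at `(r, p)` are pairs
`(a, v)` standing for `a ∂_r + v`. -/
abbrev coneModel : ModelWithCorners ℝ (ℝ × EuclideanSpace ℝ (Fin n))
    (ModelProd HalfLine (EuclideanSpace ℝ (Fin n))) :=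
  halfLineModel.prod (𝓡 n)

/-- The function `f(r, x)` on `[0,∞) × U`, `U` open in `ℝⁿ`, is given by a smooth map
`U → 𝒜, x ↦ f(·, x)`. -/
def CoefficientSpace.IsSmoothFamily (A : CoefficientSpace F) (U : Set (EuclideanSpace ℝ (Fin n)))
    (f : HalfLine → EuclideanSpace ℝ (Fin n) → ℂ) : Prop :=
  ∃ g : EuclideanSpace ℝ (Fin n) → F, IsSmoothOn U g ∧ ∀ x ∈ U, ∀ r, A.incl (g x) r = f r x

variable (n M) in
/-- `Ω^k 𝒜₀([0,∞) × M)`: smooth `k`-forms on `[0,∞) × M` which vanish for `r < ε`, for some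
`ε > 0`, and whose coefficients in the coordinates given by a chart `U` of `M` are smooth maps
from `U` to `𝒜`. The coefficients are the values on constant vector fields `w`. -/
def CoefficientSpace.forms [IsTopologicalAddGroup F] [ContinuousSMul ℂ F]
    (A : CoefficientSpace F) (k : ℕ) : Submodule ℂ (FormField (coneModel n) (HalfLine × M) k) where
  carrier := {θ | θ ∈ smoothForms (coneModel n) (HalfLine × M) k ∧
    (∃ ε : ℝ, 0 < ε ∧ ∀ (r : HalfLine) (p : M), (r : ℝ) < ε → θ (r, p) = 0) ∧
    ∀ (p₀ : M) (w : Fin k → ℝ × EuclideanSpace ℝ (Fin n)),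
      A.IsSmoothFamily (extChartAt (𝓡 n) p₀).target
        fun r x ↦ localRep (coneModel n) θ
          (⟨0, Set.self_mem_Ici⟩, p₀) ((r : ℝ), x) w}
  zero_mem' := ⟨zero_mem _, ⟨1, one_pos, fun _ _ _ ↦ rfl⟩, fun p₀ w ↦
    ⟨0, fun _ ↦ IsCkOn.zero, fun x _ r ↦ by
      simp only [Pi.zero_apply, map_zero]; rfl⟩⟩
  add_mem' := by
    rintro θ η ⟨hθ, ⟨ε, hε, hθε⟩, hθc⟩ ⟨hη, ⟨δ, hδ, hηδ⟩, hηc⟩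
    refine ⟨add_mem hθ hη, ⟨min ε δ, lt_min hε hδ, fun r p hr ↦ ?_⟩, fun p₀ w ↦ ?_⟩
    · change θ (r, p) + η (r, p) = 0
      rw [hθε r p (hr.trans_le (min_le_left _ _)), hηδ r p (hr.trans_le (min_le_right _ _)),
        add_zero]
    · obtain ⟨g, hg, hgθ⟩ := hθc p₀ w
      obtain ⟨h, hh, hhη⟩ := hηc p₀ w
      refine ⟨g + h, fun m ↦ (hg m).add (hh m), fun x hx r ↦ ?_⟩
      rw [Pi.add_apply, map_add, Pi.add_apply, hgθ x hx, hhη x hx]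
      rfl
  smul_mem' := by
    rintro c θ ⟨hθ, ⟨ε, hε, hθε⟩, hθc⟩
    refine ⟨Submodule.smul_mem _ c hθ, ⟨ε, hε, fun r p hr ↦ ?_⟩, fun p₀ w ↦ ?_⟩
    · change c • θ (r, p) = 0
      rw [hθε r p hr]
      ext w
      exact smul_zero c
    · obtain ⟨g, hg, hgθ⟩ := hθc p₀ w
      refine ⟨c • g, fun m ↦ (hg m).const_smul c, fun x hx r ↦ ?_⟩
      rw [Pi.smul_apply, map_smul, Pi.smul_apply, hgθ x hx]
      rfl

/-- The coefficient `r ↦ θ_{(r,p)}(v₁, …, v_k, ∂_r)` of `dr` in a `(k+1)`-form `θ`, for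
`v₁, …, v_k` tangent to `M`: if `θ = f₁ π^*η₁ + f₂ π^*η₂ ∧ dr` this is `f₂(·,p) η₂(v₁, …, v_k)`. -/
def fiberCoeff {k : ℕ} (θ : FormField (coneModel n) (HalfLine × M) (k + 1)) (p : M)
    (v : Fin k → TangentSpace (𝓡 n) p) : HalfLine → ℂ := fun r ↦
  θ (r, p) (Fin.snoc (α := fun _ ↦ ℝ × EuclideanSpace ℝ (Fin n)) (fun i ↦ (0, v i)) (1, 0))

theorem fiberCoeff_mem_range [IsManifold (𝓡 n) ∞ M] [IsTopologicalAddGroup F]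
    [ContinuousSMul ℂ F] (A : CoefficientSpace F) {k : ℕ} (θ : A.forms n M (k + 1)) (p : M)
    (v : Fin k → TangentSpace (𝓡 n) p) : fiberCoeff θ.1 p v ∈ LinearMap.range A.incl := by
  obtain ⟨g, -, hg⟩ := θ.2.2.2 p
    (Fin.snoc (α := fun _ ↦ ℝ × EuclideanSpace ℝ (Fin n)) (fun i ↦ (0, v i)) (1, 0))
  refine ⟨g (extChartAt (𝓡 n) p p), funext fun r ↦ ?_⟩
  rw [hg _ (mem_extChartAt_target p)]
  have : IsManifold (coneModel n) 1 (HalfLine × M) := IsManifold.of_le (n := ∞) (by simp)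
  exact localRep_self (coneModel n) θ.1 (r, p) _

/-- A multilinear map on a finite-dimensional space is continuous. -/
theorem continuous_alternatingMap {V : Type*} [NormedAddCommGroup V] [NormedSpace ℝ V]
    [FiniteDimensional ℝ V] {k : ℕ} (f : V [⋀^Fin k]→ₗ[ℝ] ℂ) : Continuous f := by
  let b := Module.finBasis ℝ V
  have h : ∀ v : Fin k → V, f v = ∑ s : Fin k → Fin (Module.finrank ℝ V),
      (∏ i, b.equivFunL (v i) (s i)) • f (fun i ↦ b (s i)) := by
    intro v
    conv_lhs => rw [show v = fun i ↦ ∑ j, b.equivFunL (v i) j • b j from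
      funext fun i ↦ (b.sum_equivFun (v i)).symm]
    have := f.toMultilinearMap.map_sum (fun i j ↦ b.equivFunL (v i) j • b j)
    refine this.trans (Finset.sum_congr rfl fun s _ ↦ ?_)
    exact f.toMultilinearMap.map_smul_univ _ _
  rw [show (f : (Fin k → V) → ℂ) = _ from funext h]
  fun_prop

theorem snoc_update {V : Type*} [AddCommGroup V] {k : ℕ} [inst : DecidableEq (Fin k)]
    (v : Fin k → V)
    (i : Fin k) (x : V) :
    (Fin.snoc (α := fun _ ↦ ℝ × V) (fun j ↦ (0, Function.update v i x j)) (1, 0) :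
      Fin (k + 1) → ℝ × V) =
    Function.update (Fin.snoc (α := fun _ ↦ ℝ × V) (fun j ↦ (0, v j)) (1, 0)) i.castSucc
      (0, x) := by
  obtain rfl : inst = instDecidableEqFin k := Subsingleton.elim _ _
  rw [← Fin.snoc_update]
  congr 1
  funext j
  by_cases h : j = i
  · subst h
    simp
  · simp [h]

/-- Inserting `∂_r` in the last slot of an alternating map. -/
def insertLast {V : Type*} [AddCommGroup V] [Module ℝ V] {k : ℕ}
    (α : (ℝ × V) [⋀^Fin (k + 1)]→ₗ[ℝ] ℂ) : V [⋀^Fin k]→ₗ[ℝ] ℂ where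
  toFun v := α (Fin.snoc (α := fun _ ↦ ℝ × V) (fun i ↦ (0, v i)) (1, 0))
  map_update_add' v i x y := by
    simp only [snoc_update]
    rw [← α.map_update_add]
    simp
  map_update_smul' v i c x := by
    simp only [snoc_update]
    rw [← α.map_update_smul]
    simp
  map_eq_zero_of_eq' v i j hv hij := by
    refine α.map_eq_zero_of_eq _ (i := i.castSucc) (j := j.castSucc) ?_
      (fun h ↦ hij (Fin.castSucc_injective _ h))
    simp [hv]

variable (M) in
/-- Integration along the fiber `π_* : Ω^{k+1} 𝒜₀([0,∞) × M) → Ω^k(M)`,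
`(π_* θ)_p(v₁, …, v_k) = ⨍ θ_{(r,p)}(v₁, …, v_k, ∂_r)`; so it sends
`f₁ π^*η₁ + f₂ π^*η₂ ∧ dr` to `(⨍ f₂) η₂`. -/
def CoefficientSpace.fiberIntegral [IsManifold (𝓡 n) ∞ M] [IsTopologicalAddGroup F]
    [ContinuousSMul ℂ F] (A : CoefficientSpace F) (k : ℕ) :
    A.forms n M (k + 1) →ₗ[ℂ] FormField (𝓡 n) M k where
  toFun θ p :=
    let φ : HalfLine → (EuclideanSpace ℝ (Fin n)) [⋀^Fin k]→ₗ[ℝ] ℂ := fun r ↦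
      insertLast (show (ℝ × EuclideanSpace ℝ (Fin n)) [⋀^Fin (k + 1)]→L[ℝ] ℂ from
        θ.1 (r, p)).toAlternatingMap
    let f : (EuclideanSpace ℝ (Fin n)) [⋀^Fin k]→ₗ[ℝ] ℂ :=
      { toFun := fun v ↦ A.integral ⟨fiberCoeff θ.1 p v, fiberCoeff_mem_range A θ p v⟩
        map_update_add' := fun v i x y ↦ by
          rw [← map_add]
          exact congrArg A.integral (Subtype.ext (funext fun r ↦ (φ r).map_update_add v i x y))
        map_update_smul' := fun v i c x ↦ by
          rw [← Complex.coe_smul, ← map_smul]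
          exact congrArg A.integral (Subtype.ext (funext fun r ↦ (φ r).map_update_smul v i c x))
        map_eq_zero_of_eq' := fun v i j hv hij ↦ by
          rw [← map_zero A.integral]
          exact congrArg A.integral
            (Subtype.ext (funext fun r ↦ (φ r).map_eq_zero_of_eq v hv hij)) }
    { f with cont := continuous_alternatingMap f }
  map_add' θ η := by
    funext p
    ext v
    exact map_add A.integral ⟨fiberCoeff θ.1 p v, fiberCoeff_mem_range A θ p v⟩
      ⟨fiberCoeff η.1 p v, fiberCoeff_mem_range A η p v⟩
  map_smul' c θ := by
    funext p
    ext v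
    exact map_smul A.integral c ⟨fiberCoeff θ.1 p v, fiberCoeff_mem_range A θ p v⟩

end Cone

end ConeThom

end

/-!
# Integration along the fiber of a cone is an isomorphism in cohomology

The proof shows that `π_*` is a surjective morphism of complexes with acyclic kernel.

*Analysis.* The functional `ρ` is not assumed to be continuous, but it is continuous on the closed
subspace `𝒜_ε ⊂ 𝒜` of the functions vanishing on `[0,ε)`. Indeed, let `a₀ ∈ 𝒜_ε` have regularized
integral `1`. As `ρ` vanishes on derivatives of functions in `𝒜_ε`, and the functions in `𝒜_ε` in its
kernel have primitives in `𝒜_ε`, the map `𝒜_ε × ℂ → 𝒜_ε, (a, c) ↦ a' + c a₀` is bijective; it is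
continuous by the closed graph theorem. By the open mapping theorem for Fréchet spaces its inverse
is continuous. The components of the inverse are `ρ` and an operator `P` of primitives
(`CoefficientSpace.exists_primitive`). So `ρ`, `P` and the derivative can be applied to smooth
families of functions in `𝒜_ε`, and such families are jointly smooth functions of `r` and `x`
(`CoefficientSpace.contDiffOn_uncurry`).

*Forms.* Everything on the manifolds is done in charts, where the exterior derivative is given by
derivatives of the coefficients (`localRep_extD`, `CoefficientSpace.localRep_extD_cone`). As `ρ`
vanishes on derivatives, `π_*` commutes with `d` (`CoefficientSpace.fiberIntegral_extD`). It is
surjective on forms, not only on closed ones, since `π_*(a₀ η ∧ dr) = η`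
(`CoefficientSpace.exists_fiberIntegral_eq`).

*Acyclicity.* A closed form in `Ω^k 𝒜₀` without component containing `dr` does not depend on `r`,
and it vanishes near `r = 0`, so it is `0` (`CoefficientSpace.eq_zero_of_hasNoRadialPart`); in
degree `0` this says that `H⁰ = 0`. If `ω = α + β ∧ dr` is closed and `π_* ω = 0`, then `γ = ± P β` is
a form without component containing `dr` such that `ω - dγ` is of this kind, so `ω = dγ`
(`CoefficientSpace.exists_extD_eq_of_fiberIntegral_eq_zero`). The assertion on cohomology follows by
a diagram chase.
-/

noncomputable section

namespace ConeThom

/-! ### The inverse mapping and closed graph theorems for Fréchet spaces -/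

section OpenMapping

open scoped Uniformity

variable {X Y : Type*} [AddCommGroup X] [UniformSpace X] [IsUniformAddGroup X] [Module ℝ X]
  [ContinuousSMul ℝ X] [AddCommGroup Y] [UniformSpace Y] [IsUniformAddGroup Y] [Module ℝ Y]
  [ContinuousSMul ℝ Y]

/-- The half of the open mapping theorem that comes from Baire's theorem: images of neighborhoods
of `0` are dense in neighborhoods of `0`. -/
theorem closure_image_mem_nhds_zero [BaireSpace Y] (T : X →ₗ[ℝ] Y)
    (hT : Function.Surjective T) {U : Set X} (hU : U ∈ 𝓝 (0 : X)) :
    closure (T '' U) ∈ 𝓝 (0 : Y) := by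
  obtain ⟨V, hV, hVU⟩ : ∃ V ∈ 𝓝 (0 : X), ∀ v ∈ V, ∀ w ∈ V, v - w ∈ U := by
    have h : Tendsto (fun p : X × X ↦ p.1 - p.2) (𝓝 0 ×ˢ 𝓝 0) (𝓝 0) := by
      rw [← nhds_prod_eq]
      simpa using (continuous_sub (G := X)).tendsto ((0 : X), (0 : X))
    obtain ⟨V, hV, h'⟩ := mem_prod_same_iff.1 (h hU)
    exact ⟨V, hV, fun v hv w hw ↦ h' (Set.mk_mem_prod hv hw)⟩
  set C := closure (T '' V)
  let c : ℕ → ℝ := fun n ↦ ((n : ℝ) + 1)⁻¹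
  have hc : ∀ n, c n ≠ 0 := fun n ↦ by positivity
  obtain ⟨n, y, hy⟩ : ∃ n, (interior {y : Y | c n • y ∈ C}).Nonempty := by
    refine nonempty_interior_of_iUnion_of_closed
      (fun n ↦ isClosed_closure.preimage (continuous_const_smul (c n))) ?_
    refine eq_univ_of_forall fun y ↦ mem_iUnion.2 ?_
    obtain ⟨x, rfl⟩ := hT y
    have hx : Tendsto (fun n ↦ c n • x) atTop (𝓝 0) := by
      simpa using (tendsto_one_div_add_atTop_nhds_zero_nat (𝕜 := ℝ)).smul_const x
    obtain ⟨n, hn⟩ := (hx.eventually hV).exists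
    exact ⟨n, subset_closure ⟨_, hn, map_smul ..⟩⟩
  have hCy : C ∈ 𝓝 (c n • y) := by
    have h : Tendsto (fun z : Y ↦ (c n)⁻¹ • z) (𝓝 (c n • y)) (𝓝 y) := by
      have := (continuous_const_smul (c n)⁻¹).tendsto (c n • y)
      rwa [inv_smul_smul₀ (hc n)] at this
    filter_upwards [h (mem_interior_iff_mem_nhds.1 hy)] with z hz
    simpa [smul_inv_smul₀ (hc n)] using hz
  have h0 : Tendsto (fun z : Y ↦ z + c n • y) (𝓝 0) (𝓝 (c n • y)) := by
    simpa using (continuous_add_const (c n • y)).tendsto (0 : Y)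
  filter_upwards [h0 hCy] with z hz
  have := map_mem_closure₂ (u := T '' U) continuous_sub hz (mem_of_mem_nhds hCy) (by
    rintro _ ⟨v, hv, rfl⟩ _ ⟨w, hw, rfl⟩
    exact ⟨v - w, hVU v hv w hw, map_sub ..⟩)
  simpa using this

theorem image_mem_nhds_zero [CompleteSpace X] [(𝓤 X).IsCountablyGenerated] [BaireSpace Y]
    [T2Space Y] (T : X →ₗ[ℝ] Y) (hTc : Continuous T) (hT : Function.Surjective T) {U : Set X}
    (hU : U ∈ 𝓝 (0 : X)) : T '' U ∈ 𝓝 (0 : Y) := by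
  have : (𝓝 (0 : X)).IsCountablyGenerated := UniformSpace.firstCountableTopology X |>.1 0
  obtain ⟨u, hu⟩ := (𝓝 (0 : X)).exists_antitone_basis
  have half : ∀ W : {W : Set X // W ∈ 𝓝 (0 : X)}, ∃ V : {W : Set X // W ∈ 𝓝 (0 : X)},
      ∀ v ∈ V.1, ∀ w ∈ V.1, v + w ∈ W.1 := fun W ↦ by
    obtain ⟨V, hV, h⟩ := exists_nhds_zero_half W.2
    exact ⟨⟨V, hV⟩, h⟩
  choose half half_spec using half
  obtain ⟨U', hU', hU'c, hU'U⟩ := exists_mem_nhds_isClosed_subset hU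
  -- `V (n + 1) + V (n + 1) ⊆ V n ∩ u n`, starting from a closed neighborhood inside `U`
  let V : ℕ → {W : Set X // W ∈ 𝓝 (0 : X)} := fun n ↦
    Nat.rec ⟨U', hU'⟩ (fun n W ↦ half ⟨W.1 ∩ u n, inter_mem W.2 (hu.1.mem_of_mem trivial)⟩) n
  have hV : ∀ n, ∀ v ∈ (V (n + 1)).1, ∀ w ∈ (V (n + 1)).1, v + w ∈ (V n).1 ∩ u n :=
    fun n ↦ half_spec ⟨(V n).1 ∩ u n, _⟩
  have hV0 : ∀ n, (0 : X) ∈ (V n).1 := fun n ↦ mem_of_mem_nhds (V n).2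
  refine mem_of_superset (closure_image_mem_nhds_zero T hT (V 1).2) fun y hy ↦ ?_
  -- successive approximation of a preimage of `y`
  have step : ∀ n (s : {s : X // y - T s ∈ closure (T '' (V (n + 1)).1)}),
      ∃ s' : {s : X // y - T s ∈ closure (T '' (V (n + 2)).1)}, s'.1 - s.1 ∈ (V (n + 1)).1 := by
    rintro n ⟨s, hs⟩
    have h1 : (fun z ↦ (y - T s) - z) ⁻¹' closure (T '' (V (n + 2)).1) ∈ 𝓝 (y - T s) := by
      refine (continuous_const.sub continuous_id).continuousAt.preimage_mem_nhds ?_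
      simpa using closure_image_mem_nhds_zero T hT (V (n + 2)).2
    obtain ⟨_, hz, x, hx, rfl⟩ := mem_closure_iff_nhds.1 hs _ h1
    refine ⟨⟨s + x, ?_⟩, by simpa using hx⟩
    rw [map_add, ← sub_sub]
    exact hz
  choose next hnext using step
  let s : ∀ n, {s : X // y - T s ∈ closure (T '' (V (n + 1)).1)} := fun n ↦
    Nat.rec ⟨0, by simpa using hy⟩ (fun n s ↦ next n s) n
  have hs : ∀ n, (s (n + 1)).1 - (s n).1 ∈ (V (n + 1)).1 := fun n ↦ hnext n (s n)
  have hs' : ∀ k n, (s (n + k)).1 - (s n).1 ∈ (V n).1 := by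
    intro k
    induction k with
    | zero => intro n; simpa using hV0 n
    | succ k ih =>
      intro n
      have := (hV n _ (hs n) _ (ih (n + 1))).1
      rwa [show n + 1 + k = n + (k + 1) by ring,
        show ∀ a b c : X, a - b + (c - a) = c - b from fun a b c ↦ by abel] at this
  have hVu : ∀ n, (V (n + 1)).1 ⊆ u n := fun n v hv ↦ by
    simpa using (hV n v hv 0 (hV0 (n + 1))).2
  have hcauchy : CauchySeq (fun n ↦ (s n).1) := by
    rw [cauchySeq_iff_tendsto, uniformity_eq_comap_nhds_zero, tendsto_comap_iff]
    have hbase : ∀ W ∈ 𝓝 (0 : X), ∃ N, ∀ m ≥ N, (s m).1 - (s N).1 ∈ W := fun W hW ↦ by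
      obtain ⟨n, -, hn⟩ := hu.1.mem_iff.1 hW
      refine ⟨n + 1, fun m hm ↦ hn (hVu n ?_)⟩
      obtain ⟨k, rfl⟩ := Nat.exists_eq_add_of_le hm
      exact hs' k (n + 1)
    intro W hW
    have h : Tendsto (fun p : X × X ↦ p.1 - p.2) (𝓝 0 ×ˢ 𝓝 0) (𝓝 0) := by
      rw [← nhds_prod_eq]
      simpa using (continuous_sub (G := X)).tendsto ((0 : X), (0 : X))
    obtain ⟨W', hW', h'⟩ := mem_prod_same_iff.1 (h hW)
    obtain ⟨N, hN⟩ := hbase W' hW'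
    refine mem_map.2 ?_
    filter_upwards [eventually_ge_atTop (N, N)] with p hp
    have := h' (Set.mk_mem_prod (hN p.2 hp.2) (hN p.1 hp.1))
    simpa using this
  obtain ⟨x, hx⟩ := cauchySeq_tendsto_of_complete hcauchy
  refine ⟨x, hU'U (hU'c.mem_of_tendsto hx (Eventually.of_forall fun n ↦ ?_)), ?_⟩
  · have h := hs' n 0
    rw [zero_add] at h
    simpa only [sub_zero] using! (show (s n).1 - 0 ∈ U' from h)
  · have h1 : Tendsto (fun n ↦ y - T (s n).1) atTop (𝓝 (y - T x)) :=
      tendsto_const_nhds.sub ((hTc.tendsto x).comp hx)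
    have h2 : Tendsto (fun n ↦ y - T (s n).1) atTop (𝓝 0) := by
      intro N hN
      obtain ⟨N', hN', hN'c, hN'N⟩ := exists_mem_nhds_isClosed_subset hN
      have hT0 : T ⁻¹' N' ∈ 𝓝 (0 : X) := hTc.continuousAt.preimage_mem_nhds (by simpa using hN')
      obtain ⟨n, -, hn⟩ := hu.1.mem_iff.1 hT0
      refine mem_map.2 ?_
      filter_upwards [eventually_ge_atTop n] with m hm
      refine hN'N (closure_minimal ?_ hN'c (s m).2)
      rintro _ ⟨v, hv, rfl⟩
      exact hn (hu.2 hm (hVu m hv))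
    exact (sub_eq_zero.1 (tendsto_nhds_unique h1 h2)).symm

/-- The inverse mapping theorem for complete metrizable topological vector spaces. -/
theorem continuous_symm_of_continuous [CompleteSpace X] [(𝓤 X).IsCountablyGenerated]
    [CompleteSpace Y] [(𝓤 Y).IsCountablyGenerated] [T2Space Y] (e : X ≃ₗ[ℝ] Y)
    (he : Continuous e) : Continuous e.symm := by
  have : BaireSpace Y := by
    let := UniformSpace.pseudoMetricSpace Y
    infer_instance
  refine continuous_of_continuousAt_zero e.symm fun U hU ↦ ?_
  rw [map_zero] at hU
  refine mem_map.2 (mem_of_superset (image_mem_nhds_zero e.toLinearMap he e.surjective hU) ?_)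
  rintro _ ⟨x, hx, rfl⟩
  simpa using hx

/-- The closed graph theorem for complete metrizable topological vector spaces. -/
theorem continuous_of_isClosed_setOf_eq [CompleteSpace X] [(𝓤 X).IsCountablyGenerated]
    [T2Space X] [CompleteSpace Y] [(𝓤 Y).IsCountablyGenerated] (T : X →ₗ[ℝ] Y)
    (hT : IsClosed {p : X × Y | p.2 = T p.1}) : Continuous T := by
  let G : Submodule ℝ (X × Y) := T.graph
  have hG : (G : Set (X × Y)) = {p | p.2 = T p.1} := by ext; simp [G]
  have : CompleteSpace G := (hG ▸ hT : IsClosed (G : Set (X × Y))).completeSpace_coe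
  have : IsUniformAddGroup G := inferInstanceAs (IsUniformAddGroup G.toAddSubgroup)
  have : (𝓤 G).IsCountablyGenerated := by
    rw [uniformity_subtype]; infer_instance
  let e : G ≃ₗ[ℝ] X := LinearEquiv.ofBijective ((LinearMap.fst ℝ X Y).comp G.subtype)
    ⟨by
      rintro ⟨⟨a, b⟩, h⟩ ⟨⟨a', b'⟩, h'⟩ (rfl : a = a')
      have h1 : b = T a := by simpa [G] using h
      have h2 : b' = T a := by simpa [G] using h'
      subst h1 h2; rfl, fun a ↦ ⟨⟨(a, T a), by simp [G]⟩, rfl⟩⟩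
  have he : Continuous e := continuous_fst.comp continuous_subtype_val
  have h := (continuous_snd.comp continuous_subtype_val).comp (continuous_symm_of_continuous e he)
  refine h.congr fun a ↦ ?_
  obtain ⟨g, rfl⟩ := e.surjective a
  change (e.symm (e g)).1.2 = T g.1.1
  rw [e.symm_apply_apply]
  exact (LinearMap.mem_graph_iff T _).1 g.2

end OpenMapping

/-! ### Smooth maps into topological vector spaces -/

section SmoothMaps

variable {E F G : Type*} [AddCommGroup E] [Module ℝ E] [TopologicalSpace E]
  [AddCommGroup F] [Module ℝ F] [TopologicalSpace F]
  [AddCommGroup G] [Module ℝ G] [TopologicalSpace G] {U : Set E}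

/-- `g'` is the derivative of `g` on `U` in the direction `v`. -/
def IsDirDeriv (U : Set E) (v : E) (g g' : E → F) : Prop :=
  ∀ x ∈ U, Tendsto (fun t : ℝ ↦ t⁻¹ • (g (x + t • v) - g x)) (𝓝[≠] 0) (𝓝 (g' x))

theorem IsSmoothOn.add [ContinuousAdd F] {g h : E → F} (hg : IsSmoothOn U g)
    (hh : IsSmoothOn U h) : IsSmoothOn U (fun x ↦ g x + h x) :=
  fun m ↦ (hg m).add (hh m)

theorem IsSmoothOn.zero : IsSmoothOn U (fun _ ↦ 0 : E → F) := fun _ ↦ IsCkOn.zero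

theorem IsSmoothOn.const_smul {F : Type*} [AddCommGroup F] [Module ℂ F] [TopologicalSpace F]
    [ContinuousSMul ℂ F] {g : E → F} (hg : IsSmoothOn U g) (c : ℂ) :
    IsSmoothOn U (fun x ↦ c • g x) :=
  fun m ↦ (hg m).const_smul c

theorem IsSmoothOn.sum [ContinuousAdd F] {ι : Type*} {s : Finset ι} {g : ι → E → F}
    (hg : ∀ i ∈ s, IsSmoothOn U (g i)) : IsSmoothOn U (fun x ↦ ∑ i ∈ s, g i x) := by
  classical
  induction s using Finset.induction_on with
  | empty => simpa using IsSmoothOn.zero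
  | insert a s ha ih =>
    simp only [Finset.sum_insert ha]
    exact (hg a (by simp)).add (ih fun i hi ↦ hg i (by simp [hi]))

variable [ContinuousAdd E] [ContinuousSMul ℝ E]

theorem eventually_add_smul_mem (hU : IsOpen U) {x : E} (hx : x ∈ U) (v : E) :
    ∀ᶠ t : ℝ in 𝓝[≠] 0, x + t • v ∈ U := by
  have h : Tendsto (fun t : ℝ ↦ x + t • v) (𝓝 0) (𝓝 x) := by
    have h : Continuous fun t : ℝ ↦ x + t • v := by fun_prop
    simpa using h.tendsto 0
  exact (h.eventually (hU.mem_nhds hx)).filter_mono nhdsWithin_le_nhds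

theorem IsCkOn.congr (hU : IsOpen U) {m : ℕ} : ∀ {g h : E → F}, IsCkOn U m g → EqOn h g U →
    IsCkOn U m h := by
  induction m with
  | zero => exact fun hg hgh ↦ ContinuousOn.congr hg hgh
  | succ m ih =>
    intro g h hg hgh
    refine ⟨hg.1.congr hgh, fun v ↦ ?_⟩
    obtain ⟨g', hg', hgm⟩ := hg.2 v
    refine ⟨g', fun x hx ↦ (hg' x hx).congr' ?_, hgm⟩
    filter_upwards [eventually_add_smul_mem hU hx v] with t ht
    rw [hgh ht, hgh hx]

theorem IsSmoothOn.congr (hU : IsOpen U) {g h : E → F} (hg : IsSmoothOn U g) (hgh : EqOn h g U) :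
    IsSmoothOn U h :=
  fun m ↦ (hg m).congr hU hgh

/-- As directional derivatives are unique, one derivative of `g` serves for all orders of
smoothness. -/
theorem IsSmoothOn.exists_isDirDeriv [T2Space F] (hU : IsOpen U) {g : E → F}
    (hg : IsSmoothOn U g) (v : E) : ∃ g' : E → F, IsDirDeriv U v g g' ∧ IsSmoothOn U g' := by
  obtain ⟨g', hg', -⟩ := (hg 1).2 v
  refine ⟨g', hg', fun m ↦ ?_⟩
  obtain ⟨h, hh, hhm⟩ := (hg (m + 1)).2 v
  exact hhm.congr hU fun x hx ↦ tendsto_nhds_unique (hg' x hx) (hh x hx)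

theorem IsDirDeriv.mem (hU : IsOpen U) {v : E} {g g' : E → F} (h : IsDirDeriv U v g g')
    {S : Submodule ℝ F} (hS : IsClosed (S : Set F)) (hgS : MapsTo g U S) : MapsTo g' U S := by
  intro x hx
  refine hS.mem_of_tendsto (h x hx) ?_
  filter_upwards [eventually_add_smul_mem hU hx v] with t ht
  exact S.smul_mem _ (S.sub_mem (hgS ht) (hgS hx))

/-- Linear maps which are continuous on a closed subspace commute with directional derivatives
of functions with values in this subspace. -/
theorem IsDirDeriv.map (hU : IsOpen U) {v : E} {g g' : E → F} (h : IsDirDeriv U v g g')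
    {S : Submodule ℝ F} (hS : IsClosed (S : Set F)) (hgS : MapsTo g U S) {L : F →ₗ[ℝ] G}
    (hL : ContinuousOn L S) : IsDirDeriv U v (L ∘ g) (L ∘ g') := by
  intro x hx
  have h1 : Tendsto (fun t : ℝ ↦ t⁻¹ • (g (x + t • v) - g x)) (𝓝[≠] 0) (𝓝[S] (g' x)) := by
    refine tendsto_nhdsWithin_iff.2 ⟨h x hx, ?_⟩
    filter_upwards [eventually_add_smul_mem hU hx v] with t ht
    exact S.smul_mem _ (S.sub_mem (hgS ht) (hgS hx))
  refine ((hL _ (h.mem hU hS hgS hx)).tendsto.comp h1).congr fun t ↦ ?_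
  simp

theorem IsCkOn.map (hU : IsOpen U) {S : Submodule ℝ F} (hS : IsClosed (S : Set F))
    {L : F →ₗ[ℝ] G} (hL : ContinuousOn L S) {m : ℕ} :
    ∀ {g : E → F}, IsCkOn U m g → MapsTo g U S → IsCkOn U m (L ∘ g) := by
  induction m with
  | zero => exact fun hg hgS ↦ hL.comp hg hgS
  | succ m ih =>
    intro g hg hgS
    refine ⟨hL.comp hg.1 hgS, fun v ↦ ?_⟩
    obtain ⟨g', hg', hgm⟩ := hg.2 v
    have h : IsDirDeriv U v g g' := hg'
    exact ⟨L ∘ g', h.map hU hS hgS hL, ih hgm (h.mem hU hS hgS)⟩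

theorem IsSmoothOn.map (hU : IsOpen U) {S : Submodule ℝ F} (hS : IsClosed (S : Set F))
    {L : F →ₗ[ℝ] G} (hL : ContinuousOn L S) {g : E → F} (hg : IsSmoothOn U g)
    (hgS : MapsTo g U S) : IsSmoothOn U (L ∘ g) :=
  fun m ↦ (hg m).map hU hS hL hgS

end SmoothMaps

section FiniteDimensional

variable {E F : Type*} [NormedAddCommGroup E] [NormedSpace ℝ E] [NormedAddCommGroup F]
  [NormedSpace ℝ F] {U : Set E}

theorem hasLineDerivAt_of_tendsto {g : E → F} {g' : F} {x v : E}
    (h : Tendsto (fun t : ℝ ↦ t⁻¹ • (g (x + t • v) - g x)) (𝓝[≠] 0) (𝓝 g')) :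
    HasLineDerivAt ℝ g g' x v :=
  hasDerivAt_iff_tendsto_slope_zero.2 (by simpa using h)

theorem isSmoothOn_of_contDiffOn (hU : IsOpen U) {g : E → F} (hg : ContDiffOn ℝ ∞ g U) :
    IsSmoothOn U g := by
  intro m
  induction m generalizing g with
  | zero => exact hg.continuousOn
  | succ m ih =>
    refine ⟨hg.continuousOn, fun v ↦ ⟨fun x ↦ fderiv ℝ g x v, fun x hx ↦ ?_, ih ?_⟩⟩
    · have hd : DifferentiableAt ℝ g x :=
        (hg.contDiffAt (hU.mem_nhds hx)).differentiableAt (by simp)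
      simpa using hasDerivAt_iff_tendsto_slope_zero.1 (hd.hasFDerivAt.hasLineDerivAt v)
    · exact (hg.fderiv_of_isOpen hU (by simp)).clm_apply contDiffOn_const

/-- A function whose partial derivatives along a basis exist near a point and are continuous there
is differentiable at this point. -/
theorem hasFDerivAt_of_hasLineDerivAt_basis {N : ℕ} (b : Module.Basis (Fin N) ℝ E)
    [FiniteDimensional ℝ E] (hU : IsOpen U) {f : E → F} {f' : Fin N → E → F}
    (hf : ∀ i, ∀ x ∈ U, HasLineDerivAt ℝ f (f' i x) x (b i))
    (hf' : ∀ i, ContinuousOn (f' i) U) {x : E} (hx : x ∈ U) :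
    HasFDerivAt f (∑ i, (LinearMap.toContinuousLinearMap (b.coord i)).smulRight (f' i x)) x := by
  -- move from `x` to `x + h` along the basis vectors, one after the other
  let S : ℕ → E → E := fun j h ↦ ∑ i : Fin N, if (i : ℕ) < j then b.repr h i • b i else 0
  have hrepr : ∀ i : Fin N, Continuous fun h ↦ b.repr h i := fun i ↦
    (LinearMap.toContinuousLinearMap (b.coord i)).continuous
  have hScont : ∀ j, Continuous (S j) := fun j ↦ by
    refine continuous_finsetSum _ fun i _ ↦ ?_
    split_ifs
    · exact (hrepr i).smul continuous_const
    · exact continuous_const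
  have hS0 : ∀ j, S j 0 = 0 := fun j ↦ by simp [S]
  have hSN : ∀ h, S N h = h := fun h ↦ by simp [S, b.sum_repr]
  have hSsucc : ∀ (j : Fin N) h, S (j + 1) h = S j h + b.repr h j • b j := fun j h ↦ by
    have : ∀ i : Fin N, (if (i : ℕ) < j + 1 then b.repr h i • b i else 0)
        = (if (i : ℕ) < j then b.repr h i • b i else 0) + if i = j then b.repr h i • b i else 0 := by
      intro i
      rcases lt_trichotomy (i : ℕ) j with hij | hij | hij
      · simp [hij, hij.trans (Nat.lt_succ_self _), Fin.ne_of_lt (show i < j from hij)]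
      · simp [Fin.ext hij]
      · simp [hij.not_gt, (Fin.ne_of_lt (show j < i from hij)).symm, show ¬ (i : ℕ) < j + 1 by omega]
    simp only [S, this, Finset.sum_add_distrib]
    simp
  have key : ∀ j : Fin N, (fun h ↦ f (x + S (j + 1) h) - f (x + S j h) - b.repr h j • f' j x)
      =o[𝓝 0] fun h ↦ h := by
    intro j
    have hcont : Continuous fun q : E × ℝ ↦ x + S j q.1 + q.2 • b j := by
      have := hScont j
      fun_prop
    have hlim : Tendsto (fun q : E × ℝ ↦ x + S j q.1 + q.2 • b j) (𝓝 0 ×ˢ 𝓝 0) (𝓝 x) := by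
      rw [← nhds_prod_eq]
      simpa [hS0] using hcont.tendsto (0, 0)
    refine Asymptotics.IsLittleO.trans_isBigO ?_
      ((LinearMap.toContinuousLinearMap (b.coord j)).isBigO_id (𝓝 0))
    rw [Asymptotics.isLittleO_iff]
    intro ε hε
    have h1 : ∀ᶠ q : E × ℝ in 𝓝 0 ×ˢ 𝓝 0, x + S j q.1 + q.2 • b j ∈ U ∧
        ‖f' j (x + S j q.1 + q.2 • b j) - f' j x‖ ≤ ε := by
      have h2 := ((hf' j).continuousAt (hU.mem_nhds hx)).tendsto.comp hlim
      filter_upwards [hlim.eventually (hU.mem_nhds hx),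
        h2.eventually (Metric.closedBall_mem_nhds _ hε)] with q hq hq'
      exact ⟨hq, by simpa [dist_eq_norm] using hq'⟩
    obtain ⟨P, hP, Q, hQ, hPQ⟩ := Filter.eventually_prod_iff.1 h1
    obtain ⟨δ, hδ, hδQ⟩ := Metric.eventually_nhds_iff_ball.1 hQ
    have h3 : ∀ᶠ h in 𝓝 (0 : E), b.repr h j ∈ Metric.ball (0 : ℝ) δ := by
      have : Tendsto (fun h ↦ b.repr h j) (𝓝 0) (𝓝 0) := by simpa using (hrepr j).tendsto 0
      exact this.eventually (Metric.ball_mem_nhds _ hδ)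
    filter_upwards [hP, h3] with h hh hj
    have hd : ∀ t ∈ Metric.ball (0 : ℝ) δ,
        HasDerivWithinAt (fun t : ℝ ↦ f (x + S j h + t • b j) - t • f' j x)
          (f' j (x + S j h + t • b j) - f' j x) (Metric.ball 0 δ) t := by
      intro t ht
      have h4 : HasDerivAt (fun s : ℝ ↦ f (x + S j h + t • b j + s • b j))
          (f' j (x + S j h + t • b j)) (t - t) := by
        rw [sub_self]
        exact hf j _ (hPQ hh (hδQ t ht)).1
      have h5 : HasDerivAt (fun s : ℝ ↦ f (x + S j h + s • b j))
          (f' j (x + S j h + t • b j)) t := by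
        refine (h4.comp_sub_const t t).congr_of_eventuallyEq (Eventually.of_forall fun s ↦ ?_)
        change f _ = f _
        congr 1
        module
      have h6 := (h5.fun_sub ((hasDerivAt_id' t).smul_const (f' j x))).hasDerivWithinAt
        (s := Metric.ball (0 : ℝ) δ)
      rwa [one_smul] at h6
    have h6 := (convex_ball (0 : ℝ) δ).norm_image_sub_le_of_norm_hasDerivWithin_le hd
      (fun t ht ↦ (hPQ hh (hδQ t ht)).2) (Metric.mem_ball_self hδ) hj
    simpa [hSsucc, add_assoc, sub_right_comm] using h6
  rw [hasFDerivAt_iff_isLittleO_nhds_zero]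
  refine (Asymptotics.IsLittleO.sum (s := Finset.univ) fun j _ ↦ key j).congr_left fun h ↦ ?_
  rw [Finset.sum_apply, Finset.sum_sub_distrib, Fin.sum_univ_eq_sum_range
    (fun j ↦ f (x + S (j + 1) h) - f (x + S j h)) N,
    Finset.sum_range_sub (fun j ↦ f (x + S j h)), hSN]
  simp [S]

/-- A function whose partial derivatives along a basis exist and are of class `C^m` is of class
`C^(m+1)`. -/
theorem contDiffOn_succ_of_hasLineDerivAt_basis {N : ℕ} (b : Module.Basis (Fin N) ℝ E)
    [FiniteDimensional ℝ E] (hU : IsOpen U) {f : E → F} {f' : Fin N → E → F}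
    (hf : ∀ i, ∀ x ∈ U, HasLineDerivAt ℝ f (f' i x) x (b i)) {m : ℕ}
    (hf' : ∀ i, ContDiffOn ℝ m (f' i) U) : ContDiffOn ℝ (m + 1 : ℕ) f U := by
  have h := fun x (hx : x ∈ U) ↦ hasFDerivAt_of_hasLineDerivAt_basis b hU hf
    (fun i ↦ (hf' i).continuousOn) hx
  have : ((m + 1 : ℕ) : WithTop ℕ∞) = (m : WithTop ℕ∞) + 1 := by norm_cast
  rw [this, contDiffOn_succ_iff_fderiv_of_isOpen hU]
  refine ⟨fun x hx ↦ (h x hx).differentiableAt.differentiableWithinAt, by simp, ?_⟩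
  refine ContDiffOn.congr ?_ fun x hx ↦ (h x hx).fderiv
  exact ContDiffOn.sum fun i _ ↦ contDiffOn_const.smulRight (hf' i)

theorem IsSmoothOn.contDiffOn [FiniteDimensional ℝ E] (hU : IsOpen U) {g : E → F}
    (hg : IsSmoothOn U g) : ContDiffOn ℝ ∞ g U := by
  rw [contDiffOn_infty]
  intro m
  have := hg m
  clear hg
  induction m generalizing g with
  | zero => exact contDiffOn_zero.2 this
  | succ m ih =>
    choose f' hf' hm using this.2
    exact contDiffOn_succ_of_hasLineDerivAt_basis (Module.finBasis ℝ E) hU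
      (fun i x hx ↦ hasLineDerivAt_of_tendsto (hf' _ x hx)) fun i ↦ ih (hm _)

end FiniteDimensional

/-! ### Analysis in the coefficient space -/

theorem IciExtend_of_nonneg (f : HalfLine → ℂ) {r : ℝ} (hr : 0 ≤ r) :
    Set.IciExtend f r = f ⟨r, hr⟩ :=
  Set.IciExtend_of_mem f hr

theorem hasDerivWithinAt_of_mem_smoothFunctions {f : HalfLine → ℂ} (hf : f ∈ smoothFunctions)
    (r : HalfLine) : HasDerivWithinAt (Set.IciExtend f) (halfDeriv f r) (Set.Ici 0) r :=
  ((ContDiffOn.differentiableOn hf (by simp)) r r.2).hasDerivWithinAt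

theorem halfDeriv_eq {f : HalfLine → ℂ} {r : HalfLine} {z : ℂ}
    (h : HasDerivWithinAt (Set.IciExtend f) z (Set.Ici 0) r) : halfDeriv f r = z :=
  h.derivWithin (uniqueDiffOn_Ici 0 r r.2)

theorem continuous_of_mem_smoothFunctions {f : HalfLine → ℂ} (hf : f ∈ smoothFunctions) :
    Continuous f := by
  have h : ContinuousOn (Set.IciExtend f) (Set.Ici 0) := ContDiffOn.continuousOn hf
  refine (continuousOn_iff_continuous_domRestrict.1 h).congr fun r ↦ ?_
  exact Set.IciExtend_coe f r

/-- Functions which vanish near `0` extend by `0` to smooth functions on the line, whose derivative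
is the extension of the one-sided derivative. -/
theorem hasDerivAt_IciExtend {f : HalfLine → ℂ} (hf : f ∈ smoothFunctions) {ε : ℝ} (hε : 0 < ε)
    (hfε : ∀ r : HalfLine, (r : ℝ) < ε → f r = 0) (r : ℝ) :
    HasDerivAt (Set.IciExtend f) (Set.IciExtend (halfDeriv f) r) r := by
  rcases lt_or_ge 0 r with hr | hr
  · rw [IciExtend_of_nonneg _ hr.le]
    exact (hasDerivWithinAt_of_mem_smoothFunctions hf ⟨r, hr.le⟩).hasDerivAt (Ici_mem_nhds hr)
  · have h0 : ∀ᶠ s in 𝓝 r, Set.IciExtend f s = (fun _ ↦ 0) s := by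
      filter_upwards [Iio_mem_nhds (hr.trans_lt hε)] with s hs
      exact hfε _ (by simpa [Set.coe_projIci] using ⟨hε, hs⟩)
    have h1 : ∀ᶠ s in 𝓝 (0 : ℝ), Set.IciExtend f s = (fun _ ↦ 0) s := by
      filter_upwards [Iio_mem_nhds hε] with s hs
      exact hfε _ (by simpa [Set.coe_projIci] using ⟨hε, hs⟩)
    have h2 : halfDeriv f ⟨0, Set.self_mem_Ici⟩ = 0 :=
      halfDeriv_eq ((hasDerivAt_const (0 : ℝ) (0 : ℂ)).congr_of_eventuallyEq h1).hasDerivWithinAt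
    rw [Set.IciExtend_of_le _ hr, h2]
    exact (hasDerivAt_const r (0 : ℂ)).congr_of_eventuallyEq h0

namespace CoefficientSpace

section Topological

variable {F : Type*} [AddCommGroup F] [Module ℂ F] [TopologicalSpace F] (A : CoefficientSpace F)

theorem continuous_incl_apply (a : F) : Continuous (A.incl a) :=
  continuous_of_mem_smoothFunctions (A.incl_mem a)

theorem continuous_halfDeriv_iterate (j : ℕ) : Continuous fun a ↦
    UniformOnFun.ofFun {K : Set HalfLine | IsCompact K} (halfDeriv^[j] (A.incl a)) := by
  have h := A.continuous_incl
  rw [smoothTopology, continuous_iInf_rng] at h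
  have h' := h j
  rwa [continuous_induced_rng] at h'

theorem continuous_halfDeriv_iterate_apply (j : ℕ) (r : HalfLine) :
    Continuous fun a ↦ halfDeriv^[j] (A.incl a) r := by
  have h := (UniformOnFun.uniformContinuous_eval_of_mem ℂ {K : Set HalfLine | IsCompact K}
    (mem_singleton r) isCompact_singleton).continuous
  exact h.comp (A.continuous_halfDeriv_iterate j)

theorem continuous_eval (r : HalfLine) : Continuous fun a ↦ A.incl a r :=
  A.continuous_halfDeriv_iterate_apply 0 r

theorem continuous_eval_uncurry : Continuous fun q : F × HalfLine ↦ A.incl q.1 q.2 := by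
  have : LocallyCompactSpace HalfLine :=
    isClosed_Ici.isClosedEmbedding_subtypeVal.locallyCompactSpace
  let Ψ : F → C(HalfLine, ℂ) := fun a ↦ ⟨A.incl a, A.continuous_incl_apply a⟩
  have hΨ : Continuous Ψ := by
    rw [ContinuousMap.isUniformEmbedding_toUniformOnFunIsCompact.isInducing.continuous_iff]
    exact A.continuous_halfDeriv_iterate 0
  exact ContinuousEval.continuous_eval.comp ((hΨ.comp continuous_fst).prodMk continuous_snd)

/-- The derivative as an operator on `𝒜`. -/
def derivative : F →ₗ[ℂ] F where
  toFun a := (A.deriv_mem a).choose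
  map_add' a b := by
    have h := fun a ↦ (A.deriv_mem a).choose_spec
    have h1 : halfDeriv (A.incl (a + b)) = halfDeriv (A.incl a) + halfDeriv (A.incl b) := by
      funext r
      rw [map_add]
      exact halfDeriv_eq ((hasDerivWithinAt_of_mem_smoothFunctions (A.incl_mem a) r).add
        (hasDerivWithinAt_of_mem_smoothFunctions (A.incl_mem b) r))
    exact A.incl_injective ((h _).trans (h1.trans
      ((congrArg₂ (· + ·) (h a) (h b)).symm.trans (map_add ..).symm)))
  map_smul' c a := by
    have h := fun a ↦ (A.deriv_mem a).choose_spec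
    have h1 : halfDeriv (A.incl (c • a)) = c • halfDeriv (A.incl a) := by
      funext r
      rw [map_smul]
      exact halfDeriv_eq
        ((hasDerivWithinAt_of_mem_smoothFunctions (A.incl_mem a) r).const_smul c)
    exact A.incl_injective ((h _).trans (h1.trans
      ((congrArg (c • ·) (h a)).symm.trans (map_smul ..).symm)))

theorem incl_derivative (a : F) : A.incl (A.derivative a) = halfDeriv (A.incl a) :=
  (A.deriv_mem a).choose_spec

/-- The elements of `𝒜` which vanish on `[0,ε)`; the space `𝒜₀` is the union of these closed
subspaces. -/
def vanishing (ε : ℝ) : Submodule ℂ F where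
  carrier := {a | ∀ r : HalfLine, (r : ℝ) < ε → A.incl a r = 0}
  zero_mem' r _ := by simp
  add_mem' ha hb r hr := by simp [ha r hr, hb r hr]
  smul_mem' c a ha r hr := by simp [ha r hr]

theorem mem_vanishing {ε : ℝ} {a : F} :
    a ∈ A.vanishing ε ↔ ∀ r : HalfLine, (r : ℝ) < ε → A.incl a r = 0 :=
  Iff.rfl

theorem isClosed_vanishing (ε : ℝ) : IsClosed (A.vanishing ε : Set F) := by
  have : (A.vanishing ε : Set F) = ⋂ (r : HalfLine) (_ : (r : ℝ) < ε), {a | A.incl a r = 0} := by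
    ext a
    simp [mem_vanishing]
  rw [this]
  exact isClosed_biInter fun r _ ↦ isClosed_eq (A.continuous_eval r) continuous_const

variable {A} {ε : ℝ} {a : F}

theorem hasDerivAt_of_mem_vanishing (hε : 0 < ε) (ha : a ∈ A.vanishing ε) (r : ℝ) :
    HasDerivAt (Set.IciExtend (A.incl a)) (Set.IciExtend (A.incl (A.derivative a)) r) r := by
  rw [incl_derivative]
  exact hasDerivAt_IciExtend (A.incl_mem a) hε ha r

theorem derivative_mem_vanishing (hε : 0 < ε) (ha : a ∈ A.vanishing ε) :
    A.derivative a ∈ A.vanishing ε := by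
  intro r hr
  have h0 : ∀ᶠ s in 𝓝 (r : ℝ), Set.IciExtend (A.incl a) s = (fun _ ↦ 0) s := by
    filter_upwards [Iio_mem_nhds hr] with s hs
    exact ha _ (by simpa [Set.coe_projIci] using ⟨hε, hs⟩)
  have h1 := hasDerivAt_of_mem_vanishing hε ha r
  rw [Set.IciExtend_coe] at h1
  exact h1.unique ((hasDerivAt_const (r : ℝ) (0 : ℂ)).congr_of_eventuallyEq h0)

theorem reg_derivative (hε : 0 < ε) (ha : a ∈ A.vanishing ε) : A.reg (A.derivative a) = 0 :=
  A.reg_deriv a _ ⟨ε, hε, ha⟩ (A.incl_derivative a)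

theorem eq_zero_of_derivative_eq_zero (hε : 0 < ε) (ha : a ∈ A.vanishing ε)
    (h : A.derivative a = 0) : a = 0 := by
  refine A.incl_injective (funext fun r ↦ ?_)
  have hd := hasDerivAt_of_mem_vanishing hε ha
  have h0 : ∀ s, Set.IciExtend (A.incl (A.derivative a)) s = 0 := fun s ↦ by
    simp [h, Set.IciExtend]
  have h1 := is_const_of_deriv_eq_zero (fun s ↦ (hd s).differentiableAt)
    (fun s ↦ (hd s).deriv.trans (h0 s)) r (0 : ℝ)
  rw [Set.IciExtend_coe, Set.IciExtend_self, ha ⟨0, Set.self_mem_Ici⟩ hε] at h1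
  rw [h1, map_zero, Pi.zero_apply]

theorem exists_derivative_eq (hε : 0 < ε) (ha : a ∈ A.vanishing ε) (hreg : A.reg a = 0) :
    ∃ b ∈ A.vanishing ε, A.derivative b = a := by
  obtain ⟨b, hb⟩ := A.primitive_mem a ⟨ε, hε, ha⟩ hreg
  refine ⟨b, fun r hr ↦ ?_, A.incl_injective ?_⟩
  · rw [hb, intervalIntegral.integral_congr (g := fun _ ↦ 0), intervalIntegral.integral_zero]
    intro s hs
    rw [uIcc_of_le r.2] at hs
    change Set.IciExtend (A.incl a) s = 0
    rw [IciExtend_of_nonneg _ hs.1]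
    exact ha _ (hs.2.trans_lt hr)
  · rw [incl_derivative]
    funext r
    have hc : Continuous (Set.IciExtend (A.incl a)) :=
      (A.continuous_incl_apply a).comp ((continuous_const.max continuous_id).subtype_mk _)
    have h := (hc.integral_hasStrictDerivAt 0 r).hasDerivAt.hasDerivWithinAt (s := Set.Ici 0)
    rw [Set.IciExtend_coe] at h
    refine halfDeriv_eq (h.congr (fun s hs ↦ ?_) ?_)
    · rw [IciExtend_of_nonneg _ hs, hb]
    · rw [Set.IciExtend_coe, hb]

theorem hasCompactSupport_of_forall_lt {f : HalfLine → ℂ} {N : ℝ}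
    (h : ∀ r : HalfLine, N < r → f r = 0) : HasCompactSupport f := by
  have hK : IsCompact ((Subtype.val : HalfLine → ℝ) ⁻¹' Set.Icc 0 N) :=
    isClosed_Ici.isClosedEmbedding_subtypeVal.isCompact_preimage isCompact_Icc
  refine HasCompactSupport.of_support_subset_isCompact hK fun r hr ↦ ?_
  exact ⟨r.2, not_lt.1 fun hlt ↦ hr (h r hlt)⟩

theorem exists_incl_eq_of_contDiff {f : ℝ → ℂ} (hf : ContDiffOn ℝ ∞ f (Set.Ici 0)) {N : ℝ}
    (hN : ∀ r, N < r → f r = 0) : ∃ a, ∀ r : HalfLine, A.incl a r = f r := by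
  obtain ⟨m, hm⟩ := exists_nat_gt N
  obtain ⟨j, hj, -⟩ := A.test_embedding m
  have hmem : (fun r : HalfLine ↦ f r) ∈ testFunctions m := by
    refine ⟨ContDiffOn.congr hf fun r hr ↦ ?_, fun r hr ↦ hN r (hm.trans hr)⟩
    exact IciExtend_of_nonneg _ hr
  exact ⟨j ⟨_, hmem⟩, fun r ↦ by rw [hj]⟩

variable (A) in
/-- The regularized integral does not vanish on the elements of `𝒜` which vanish on `[0,ε)`: if it
is a nonzero multiple of the integral on test functions take a bump function, and if it vanishes on
test functions then cutting off near `0` does not change it. -/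
theorem exists_reg_eq_one (hε : 0 < ε) : ∃ a ∈ A.vanishing ε, A.reg a = 1 := by
  suffices h : ∃ a ∈ A.vanishing ε, A.reg a ≠ 0 by
    obtain ⟨a, ha, h⟩ := h
    exact ⟨(A.reg a)⁻¹ • a, Submodule.smul_mem _ _ ha, by simp [h]⟩
  obtain ⟨c, hc⟩ := A.reg_test
  by_cases hc0 : c = 0
  · obtain ⟨a, ha⟩ : ∃ a, A.reg a ≠ 0 := by
      by_contra! h
      exact A.reg_ne_zero (LinearMap.ext h)
    let χ : ContDiffBump (0 : ℝ) := ⟨ε, ε + 1, hε, by linarith⟩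
    have hχ0 : ∀ r : ℝ, ε + 1 < r → χ r = 0 := fun r hr ↦
      χ.zero_of_le_dist (by
        rw [Real.dist_eq, sub_zero]
        exact hr.le.trans (le_abs_self r))
    have hχ1 : ∀ r : ℝ, 0 ≤ r → r < ε → χ r = 1 := fun r h0 hr ↦
      χ.one_of_mem_closedBall (by
        rw [Metric.mem_closedBall, Real.dist_eq, sub_zero, abs_of_nonneg h0]
        exact hr.le)
    obtain ⟨b, hb⟩ := exists_incl_eq_of_contDiff (A := A)
      (f := fun r ↦ χ r • Set.IciExtend (A.incl a) r)
      (χ.contDiff.contDiffOn.smul (A.incl_mem a)) (N := ε + 1) fun r hr ↦ by simp [hχ0 r hr]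
    refine ⟨a - b, fun r hr ↦ ?_, ?_⟩
    · rw [map_sub, Pi.sub_apply, hb, hχ1 r r.2 hr, one_smul, Set.IciExtend_coe, sub_self]
    · have : A.reg b = 0 := by
        rw [hc b, hc0, zero_mul]
        refine hasCompactSupport_of_forall_lt (N := ε + 1) fun r hr ↦ ?_
        rw [hb, hχ0 r hr, zero_smul]
      rwa [map_sub, this, sub_zero]
  · let χ : ContDiffBump (ε + 2 : ℝ) := ⟨1 / 2, 1, by norm_num, by norm_num⟩
    have hχ0 : ∀ r : ℝ, ¬ (ε + 1 < r ∧ r < ε + 3) → χ r = 0 := fun r hr ↦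
      χ.zero_of_le_dist (by
        rw [Real.dist_eq]
        change 1 ≤ _
        by_contra! h
        exact hr ⟨by linarith [(abs_lt.1 h).1], by linarith [(abs_lt.1 h).2]⟩)
    obtain ⟨a, ha⟩ := exists_incl_eq_of_contDiff (A := A)
      (f := fun r ↦ ((χ r : ℝ) : ℂ)) (N := ε + 3)
      (Complex.ofRealCLM.contDiff.comp χ.contDiff).contDiffOn
      fun r hr ↦ by simp [hχ0 r (fun h ↦ hr.not_gt h.2)]
    refine ⟨a, fun r hr ↦ ?_, ?_⟩
    · rw [ha, hχ0 r fun h ↦ by linarith [h.1], Complex.ofReal_zero]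
    · rw [hc a]
      · refine mul_ne_zero hc0 ?_
        have h1 : ∫ r in Set.Ioi (0 : ℝ), Set.IciExtend (A.incl a) r = ∫ r, ((χ r : ℝ) : ℂ) := by
          rw [setIntegral_congr_fun measurableSet_Ioi (g := fun r ↦ ((χ r : ℝ) : ℂ))]
          · refine setIntegral_eq_integral_of_forall_compl_eq_zero fun r hr ↦ ?_
            rw [hχ0 r fun h ↦ hr (by rw [mem_Ioi]; linarith [h.1]), Complex.ofReal_zero]
          · intro r hr
            rw [IciExtend_of_nonneg _ (le_of_lt hr), ha]
        rw [h1, integral_complex_ofReal]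
        exact_mod_cast χ.integral_pos.ne'
      · refine hasCompactSupport_of_forall_lt (N := ε + 3) fun r hr ↦ ?_
        rw [ha, hχ0 r fun h ↦ hr.not_gt h.2, Complex.ofReal_zero]

end Topological

section Frechet

open scoped Uniformity

variable {F : Type*} [AddCommGroup F] [Module ℂ F] [UniformSpace F] [IsUniformAddGroup F]
  [ContinuousSMul ℂ F] [CompleteSpace F] [T2Space F] [(𝓤 F).IsCountablyGenerated]
  (A : CoefficientSpace F)

theorem continuous_derivative : Continuous A.derivative := by
  have : ContinuousSMul ℝ F := IsScalarTower.continuousSMul ℂ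
  refine continuous_of_isClosed_setOf_eq (A.derivative.restrictScalars ℝ) ?_
  have h : {p : F × F | p.2 = A.derivative.restrictScalars ℝ p.1}
      = ⋂ r, {p : F × F | A.incl p.2 r = halfDeriv^[1] (A.incl p.1) r} := by
    ext p
    simp only [mem_ofPred_eq, mem_iInter, LinearMap.restrictScalars_apply,
      ← A.incl_injective.eq_iff, incl_derivative, Function.iterate_one]
    exact funext_iff
  rw [h]
  exact isClosed_iInter fun r ↦ isClosed_eq ((A.continuous_eval r).comp continuous_snd)
    ((A.continuous_halfDeriv_iterate_apply 1 r).comp continuous_fst)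

/-- The regularized integral is automatically continuous on the functions vanishing on `[0,ε)`,
and there is a continuous operator of primitives: for `a₀` with regularized integral `1`, the map
`(a, c) ↦ a' + c • a₀` is a continuous bijection of Fréchet spaces, and its inverse maps `a` to its
regularized integral and to a primitive of `a` if this integral vanishes. -/
theorem exists_primitive {ε : ℝ} (hε : 0 < ε) : ContinuousOn A.reg (A.vanishing ε) ∧
    ∃ P : F →ₗ[ℂ] F, ContinuousOn P (A.vanishing ε) ∧ ∀ a ∈ A.vanishing ε,
      P a ∈ A.vanishing ε ∧ (A.reg a = 0 → A.derivative (P a) = a) := by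
  have : ContinuousSMul ℝ F := IsScalarTower.continuousSMul ℂ
  obtain ⟨a₀, ha₀, hreg⟩ := A.exists_reg_eq_one hε
  let S := A.vanishing ε
  have : CompleteSpace S := (A.isClosed_vanishing ε).completeSpace_coe
  have : IsUniformAddGroup S := inferInstanceAs (IsUniformAddGroup S.toAddSubgroup)
  have : (𝓤 S).IsCountablyGenerated := by
    rw [uniformity_subtype]; infer_instance
  have : ContinuousSMul ℝ S := IsScalarTower.continuousSMul ℂ
  let T : (S × ℂ) →ₗ[ℂ] S := LinearMap.coprod
    (A.derivative.restrict fun a ha ↦ derivative_mem_vanishing hε ha)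
    (LinearMap.toSpanSingleton ℂ S ⟨a₀, ha₀⟩)
  have hT : ∀ q, (T q : F) = A.derivative q.1 + q.2 • a₀ := fun q ↦ rfl
  have hregT : ∀ q, A.reg (T q) = q.2 := fun q ↦ by
    rw [hT, map_add, map_smul, hreg, reg_derivative hε q.1.2]
    simp
  have hinj : Function.Injective T := by
    rw [← LinearMap.ker_eq_bot, LinearMap.ker_eq_bot']
    intro q hq
    have h1 := hregT q
    rw [hq] at h1
    have h2 : q.2 = 0 := by simpa using h1.symm
    have h3 := hT q
    rw [hq, h2, zero_smul, add_zero] at h3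
    exact Prod.ext (Subtype.ext (eq_zero_of_derivative_eq_zero hε q.1.2 h3.symm)) h2
  have hsurj : Function.Surjective T := by
    intro b
    obtain ⟨a, ha, hab⟩ := exists_derivative_eq hε
      (S.sub_mem b.2 (S.smul_mem (A.reg b) ha₀)) (by simp [hreg])
    refine ⟨(⟨a, ha⟩, A.reg b), Subtype.ext ?_⟩
    rw [hT, hab, sub_add_cancel]
  let e : (S × ℂ) ≃ₗ[ℂ] S := LinearEquiv.ofBijective T ⟨hinj, hsurj⟩
  have he : Continuous e := by
    refine Continuous.subtype_mk (f := fun q : S × ℂ ↦ A.derivative q.1 + q.2 • a₀) ?_ _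
    have := A.continuous_derivative
    fun_prop
  have hes : Continuous e.symm := continuous_symm_of_continuous (e.restrictScalars ℝ) he
  have heT : ∀ a : S, T (e.symm a) = a := e.apply_symm_apply
  have hsnd : ∀ a : S, (e.symm a).2 = A.reg a := fun a ↦ by
    rw [← hregT (e.symm a), heT]
  refine ⟨?_, ?_⟩
  · rw [continuousOn_iff_continuous_domRestrict]
    exact (continuous_snd.comp hes).congr hsnd
  · obtain ⟨P, hP⟩ := LinearMap.exists_extend
      (S.subtype ∘ₗ LinearMap.fst ℂ S ℂ ∘ₗ e.symm.toLinearMap)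
    have hP' : ∀ a : S, P a = ((e.symm a).1 : F) := fun a ↦ LinearMap.congr_fun hP a
    refine ⟨P, ?_, fun a ha ↦ ⟨?_, fun h ↦ ?_⟩⟩
    · rw [continuousOn_iff_continuous_domRestrict]
      exact (continuous_subtype_val.comp (continuous_fst.comp hes)).congr fun a ↦ (hP' a).symm
    · rw [hP' ⟨a, ha⟩]
      exact (e.symm ⟨a, ha⟩).1.2
    · have h1 := hT (e.symm ⟨a, ha⟩)
      rw [heT, hsnd, h, zero_smul, add_zero] at h1
      rw [hP' ⟨a, ha⟩, ← h1]

end Frechet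

end CoefficientSpace

/-! ### Smooth families of functions in the coefficient space -/

namespace CoefficientSpace

section

variable {E F : Type*} [AddCommGroup F] [Module ℂ F] [TopologicalSpace F]

/-- The function `(r, x) ↦ g(x)(r)` given by a family `g` of elements of `𝒜`, extended to
negative `r` by the values at `r = 0`. -/
def uncurry (A : CoefficientSpace F) (g : E → F) : ℝ × E → ℂ :=
  fun y ↦ Set.IciExtend (A.incl (g y.2)) y.1

theorem uncurry_apply (A : CoefficientSpace F) (g : E → F) (r : HalfLine)
    (x : E) : A.uncurry g ((r : ℝ), x) = A.incl (g x) r :=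
  Set.IciExtend_coe _ r

theorem continuousOn_uncurry [TopologicalSpace E] (A : CoefficientSpace F) {g : E → F} {U : Set E}
    (hg : ContinuousOn g U) : ContinuousOn (A.uncurry g) (univ ×ˢ U) := by
  have h : Continuous fun r : ℝ ↦ Set.projIci 0 r :=
    (continuous_const.max continuous_id).subtype_mk _
  refine A.continuous_eval_uncurry.comp_continuousOn (f := fun y : ℝ × E ↦
    (g y.2, Set.projIci 0 y.1)) (ContinuousOn.prodMk ?_ (h.comp continuous_fst).continuousOn)
  exact hg.comp continuousOn_snd fun y hy ↦ hy.2

end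

variable {E F : Type*} [NormedAddCommGroup E] [NormedSpace ℝ E] [AddCommGroup F] [Module ℂ F]

theorem exists_basis_prod [FiniteDimensional ℝ E] :
    ∃ (N : ℕ) (b : Module.Basis (Fin N) ℝ (ℝ × E)), ∀ i, b i = (1, 0) ∨ ∃ v, b i = (0, v) := by
  let b := (Module.Basis.singleton Unit ℝ).prod (Module.finBasis ℝ E)
  refine ⟨_, b.reindex (Fintype.equivFin _), fun i ↦ ?_⟩
  rw [Module.Basis.reindex_apply]
  rcases (Fintype.equivFin _).symm i with u | j
  · left
    simp [b]
  · right
    exact ⟨Module.finBasis ℝ E j, by simp [b]⟩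

variable [UniformSpace F] (A : CoefficientSpace F) {U : Set E} {ε : ℝ} {g : E → F}

theorem hasLineDerivAt_uncurry_fst (hε : 0 < ε) (hgS : MapsTo g U (A.vanishing ε)) {y : ℝ × E}
    (hy : y.2 ∈ U) : HasLineDerivAt ℝ (A.uncurry g) (A.uncurry (A.derivative ∘ g) y) y (1, 0) := by
  have h : HasDerivAt (Set.IciExtend (A.incl (g y.2)))
      (Set.IciExtend (A.incl (A.derivative (g y.2))) y.1) (y.1 + 0) := by
    rw [add_zero]
    exact hasDerivAt_of_mem_vanishing hε (hgS hy) y.1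
  refine (h.comp_const_add y.1 0).congr_of_eventuallyEq (Eventually.of_forall fun t ↦ ?_)
  simp [uncurry]

theorem hasLineDerivAt_uncurry_snd {v : E} {g' : E → F} (hg : IsDirDeriv U v g g') {y : ℝ × E}
    (hy : y.2 ∈ U) : HasLineDerivAt ℝ (A.uncurry g) (A.uncurry g' y) y (0, v) := by
  refine hasLineDerivAt_of_tendsto ?_
  refine (((A.continuous_eval (Set.projIci 0 y.1)).tendsto _).comp (hg y.2 hy)).congr fun t ↦ ?_
  simp [uncurry, Set.IciExtend]

variable [IsUniformAddGroup F] [ContinuousSMul ℂ F] [CompleteSpace F] [T2Space F]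
  [(uniformity F).IsCountablyGenerated]

variable {A} in
theorem isSmoothOn_derivative (hU : IsOpen U) (hg : IsSmoothOn U g) :
    IsSmoothOn U (A.derivative ∘ g) :=
  hg.map (L := A.derivative.restrictScalars ℝ) hU (S := ⊤) isClosed_univ
    A.continuous_derivative.continuousOn (mapsTo_univ _ _)

variable [FiniteDimensional ℝ E]

/-- Smooth families of elements of `𝒜` which vanish on `[0,ε)` are jointly smooth functions. -/
theorem contDiffOn_uncurry (hε : 0 < ε) (hU : IsOpen U) (hg : IsSmoothOn U g)
    (hgS : MapsTo g U (A.vanishing ε)) : ContDiffOn ℝ ∞ (A.uncurry g) (univ ×ˢ U) := by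
  rw [contDiffOn_infty]
  intro m
  induction m generalizing g with
  | zero => exact contDiffOn_zero.2 (A.continuousOn_uncurry (hg 0))
  | succ m ih =>
    obtain ⟨N, b, hb⟩ := exists_basis_prod (E := E)
    have h : ∀ i, ∃ f' : ℝ × E → ℂ,
        (∀ y ∈ (univ : Set ℝ) ×ˢ U, HasLineDerivAt ℝ (A.uncurry g) (f' y) y (b i)) ∧
        ContDiffOn ℝ m f' (univ ×ˢ U) := fun i ↦ by
      rcases hb i with hi | ⟨v, hi⟩
      · rw [hi]
        exact ⟨_, fun y hy ↦ A.hasLineDerivAt_uncurry_fst hε hgS hy.2,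
          ih (isSmoothOn_derivative hU hg) fun x hx ↦ derivative_mem_vanishing hε (hgS hx)⟩
      · rw [hi]
        obtain ⟨g', hg', hs⟩ := hg.exists_isDirDeriv hU v
        exact ⟨_, fun y hy ↦ A.hasLineDerivAt_uncurry_snd hg' hy.2, ih hs
          (hg'.mem hU (S := (A.vanishing ε).restrictScalars ℝ) (A.isClosed_vanishing ε) hgS)⟩
    choose f' hf' hm using h
    exact contDiffOn_succ_of_hasLineDerivAt_basis b (isOpen_univ.prod hU) hf' hm

theorem differentiableAt_uncurry (hε : 0 < ε) (hU : IsOpen U) (hg : IsSmoothOn U g)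
    (hgS : MapsTo g U (A.vanishing ε)) {y : ℝ × E} (hy : y.2 ∈ U) :
    DifferentiableAt ℝ (A.uncurry g) y :=
  ((A.contDiffOn_uncurry hε hU hg hgS).contDiffAt
    ((isOpen_univ.prod hU).mem_nhds ⟨mem_univ _, hy⟩)).differentiableAt (by simp)

theorem fderiv_uncurry (hε : 0 < ε) (hU : IsOpen U) (hg : IsSmoothOn U g)
    (hgS : MapsTo g U (A.vanishing ε)) {y w : ℝ × E} (hy : y.2 ∈ U) {g' : E → F}
    (hg' : IsDirDeriv U w.2 g g') : fderiv ℝ (A.uncurry g) y w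
      = A.uncurry (fun x ↦ w.1 • A.derivative (g x) + g' x) y := by
  have h := A.differentiableAt_uncurry hε hU hg hgS hy
  have h1 := (A.hasLineDerivAt_uncurry_fst hε hgS hy).lineDeriv
  have h2 := (A.hasLineDerivAt_uncurry_snd hg' hy).lineDeriv
  rw [h.lineDeriv_eq_fderiv] at h1 h2
  have hw : w = w.1 • ((1 : ℝ), (0 : E)) + (0, w.2) := by simp
  conv_lhs => rw [hw]
  rw [map_add, map_smul, h1, h2]
  simp [uncurry, Set.IciExtend]

end CoefficientSpace

/-! ### The exterior derivative in charts -/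

theorem minSmoothness_two_le : minSmoothness ℝ 2 ≤ ∞ := by
  rw [minSmoothness_of_isRCLikeNormedField]
  exact WithTop.coe_le_coe.2 (le_top : (2 : ℕ∞) ≤ ⊤)

section Charts

variable {E : Type*} [NormedAddCommGroup E] [NormedSpace ℝ E] {H : Type*} [TopologicalSpace H]
  {I : ModelWithCorners ℝ E H} {M : Type*} [TopologicalSpace M] [ChartedSpace H M]

theorem FormField.apply_congr {k : ℕ} (θ : FormField I M k) {x y : M} (h : x = y)
    (w : Fin k → E) :
    (show E [⋀^Fin k]→L[ℝ] ℂ from θ x) w = (show E [⋀^Fin k]→L[ℝ] ℂ from θ y) w := by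
  subst h
  rfl

theorem localRep_apply {k : ℕ} (θ : FormField I M k) (x₀ : M) (y : E) (w : Fin k → E) :
    localRep I θ x₀ y w = (show E [⋀^Fin k]→L[ℝ] ℂ from θ ((extChartAt I x₀).symm y))
      (fun i ↦ mfderivWithin 𝓘(ℝ, E) I (extChartAt I x₀).symm (range I) y (w i)) :=
  rfl

theorem extD_sub {k : ℕ} {θ η : FormField I M k} (hθ : θ ∈ smoothForms I M k)
    (hη : η ∈ smoothForms I M k) : extD I (θ - η) = extD I θ - extD I η :=
  (extDLinear I M k).map_sub ⟨θ, hθ⟩ ⟨η, hη⟩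

variable [IsManifold I ∞ M]

theorem extDerivWithin_range_eq_extD {k : ℕ} (θ : FormField I M k) (x : M) (w : Fin (k + 1) → E) :
    extD I θ x w = extDerivWithin (localRep I θ x) (range I) (extChartAt I x x) w := by
  have : IsManifold I 1 M := IsManifold.of_le (n := ∞) (by simp)
  have h := mfderiv_extChartAt_self (I := I) (x := x)
  exact congrArg (extDerivWithin (localRep I θ x) (range I) (extChartAt I x x))
    (funext fun i ↦ DFunLike.congr_fun h (w i))

/-- Change of charts for the coordinate expressions of a form. -/
theorem localRep_eq_pullback {k : ℕ} (θ : FormField I M k) {x₀ q : M} {z : E}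
    (hz : z ∈ (extChartAt I x₀).target) (hzq : (extChartAt I x₀).symm z ∈ (extChartAt I q).source) :
    localRep I θ x₀ z = (localRep I θ q ((extChartAt I q ∘ (extChartAt I x₀).symm) z)
      ).compContinuousLinearMap
        (fderivWithin ℝ (extChartAt I q ∘ (extChartAt I x₀).symm) (range I) z) := by
  have : IsManifold I 1 M := IsManifold.of_le (n := ∞) (by simp)
  set τ := extChartAt I q ∘ (extChartAt I x₀).symm with hτ
  have hzr : z ∈ range I := extChartAt_target_subset_range x₀ hz
  have hu : UniqueMDiffWithinAt 𝓘(ℝ, E) (range I) z :=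
    (I.uniqueDiffOn z hzr).uniqueMDiffWithinAt
  have hτz : τ z ∈ (extChartAt I q).target := (extChartAt I q).map_source hzq
  have h1 : MDifferentiableWithinAt 𝓘(ℝ, E) I (extChartAt I x₀).symm (range I) z :=
    mdifferentiableWithinAt_extChartAt_symm hz
  have h2 : MDifferentiableAt I 𝓘(ℝ, E) (extChartAt I q) ((extChartAt I x₀).symm z) :=
    mdifferentiableAt_extChartAt (by simpa using hzq)
  have h3 : MDifferentiableWithinAt 𝓘(ℝ, E) 𝓘(ℝ, E) τ (range I) z :=
    h2.comp_mdifferentiableWithinAt z h1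
  have h4 : MDifferentiableWithinAt 𝓘(ℝ, E) I (extChartAt I q).symm (range I) (τ z) :=
    mdifferentiableWithinAt_extChartAt_symm hτz
  have hmaps : MapsTo τ (range I) (range I) := fun y _ ↦ by
    rw [hτ, Function.comp_apply, extChartAt_coe]
    exact mem_range_self _
  have h5 := mfderivWithin_comp z h4 h3 hmaps hu
  have hnhds : ∀ᶠ y in 𝓝[range I] z, (extChartAt I q).symm (τ y) = (extChartAt I x₀).symm y := by
    have hc : ContinuousWithinAt (extChartAt I x₀).symm (range I) z := h1.continuousWithinAt
    filter_upwards [hc.preimage_mem_nhdsWithin ((isOpen_extChartAt_source q).mem_nhds hzq)]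
      with y hy
    exact (extChartAt I q).left_inv hy
  have h6 : mfderivWithin 𝓘(ℝ, E) I ((extChartAt I q).symm ∘ τ) (range I) z
      = mfderivWithin 𝓘(ℝ, E) I (extChartAt I x₀).symm (range I) z :=
    Filter.EventuallyEq.mfderivWithin_eq hnhds ((extChartAt I q).left_inv hzq)
  ext w
  rw [localRep_apply]
  refine (θ.apply_congr ((extChartAt I q).left_inv hzq).symm _).trans ?_
  change _ = (show E [⋀^Fin k]→L[ℝ] ℂ from θ _) _
  refine congrArg (show E [⋀^Fin k]→L[ℝ] ℂ from θ ((extChartAt I q).symm (τ z)))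
    (funext fun i ↦ ?_)
  rw [← mfderivWithin_eq_fderivWithin]
  exact DFunLike.congr_fun (h6.symm.trans h5) (w i)

/-- The exterior derivative, which is defined with a different chart at every point, is given
by the exterior derivative of the coordinate expression in every chart. -/
theorem localRep_extD {k : ℕ} {θ : FormField I M k} (hθ : θ ∈ smoothForms I M k) {x₀ : M} {y : E}
    (hy : y ∈ (extChartAt I x₀).target) :
    localRep I (extD I θ) x₀ y = extDerivWithin (localRep I θ x₀) (range I) y := by
  have : IsManifold I 1 M := IsManifold.of_le (n := ∞) (by simp)
  set q := (extChartAt I x₀).symm y with hq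
  set τ := extChartAt I q ∘ (extChartAt I x₀).symm with hτ
  have hyr : y ∈ range I := extChartAt_target_subset_range x₀ hy
  have hu : UniqueMDiffWithinAt 𝓘(ℝ, E) (range I) y :=
    (I.uniqueDiffOn y hyr).uniqueMDiffWithinAt
  have h1 : MDifferentiableWithinAt 𝓘(ℝ, E) I (extChartAt I x₀).symm (range I) y :=
    mdifferentiableWithinAt_extChartAt_symm hy
  have h2 : MDifferentiableAt I 𝓘(ℝ, E) (extChartAt I q) ((extChartAt I x₀).symm y) :=
    mdifferentiableAt_extChartAt (mem_chart_source H q)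
  have hmaps : MapsTo τ (range I) (range I) := fun y _ ↦ by
    rw [hτ, Function.comp_apply, extChartAt_coe]
    exact mem_range_self _
  have hsmooth : ContDiffWithinAt ℝ ∞ τ (range I) y := by
    refine contDiffWithinAt_ext_coord_change q x₀ ?_
    rw [PartialEquiv.trans_source, PartialEquiv.symm_source]
    exact ⟨hy, mem_extChartAt_source (I := I) q⟩
  have heq : ∀ᶠ z in 𝓝[range I] y, localRep I θ x₀ z
      = (localRep I θ q (τ z)).compContinuousLinearMap (fderivWithin ℝ τ (range I) z) := by
    filter_upwards [extChartAt_target_mem_nhdsWithin_of_mem hy,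
      h1.continuousWithinAt.preimage_mem_nhdsWithin
        ((isOpen_extChartAt_source (I := I) q).mem_nhds (mem_extChartAt_source q))] with z hz hzq
    exact localRep_eq_pullback θ hz hzq
  rw [Filter.EventuallyEq.extDerivWithin_eq_of_mem heq hyr]
  have hd : DifferentiableWithinAt ℝ (localRep I θ q) (range I) (τ y) :=
    differentiableWithinAt_localRep I hθ q
  rw [extDerivWithin_pullback hd hsmooth minSmoothness_two_le I.uniqueDiffOn
    (I.range_subset_closure_interior hyr) hyr hmaps, ← mfderivWithin_eq_fderivWithin]
  have h3 := mfderiv_comp_mfderivWithin y h2 h1 hu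
  ext w
  rw [localRep_apply]
  change extDerivWithin (localRep I θ q) (range I) (extChartAt I q q) _
    = extDerivWithin (localRep I θ q) (range I) (extChartAt I q q) _
  congr 1
  funext i
  exact (DFunLike.congr_fun h3 (w i)).symm

theorem extD_extD {k : ℕ} {θ : FormField I M k} (hθ : θ ∈ smoothForms I M k) :
    extD I (extD I θ) = 0 := by
  funext x
  suffices h0 : ∀ w : Fin (k + 2) → E, extD I (extD I θ) x w = 0 from
    ContinuousAlternatingMap.ext h0
  intro w
  rw [extDerivWithin_range_eq_extD]
  have h : ∀ᶠ y in 𝓝[range I] (extChartAt I x x), localRep I (extD I θ) x y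
      = extDerivWithin (localRep I θ x) (range I) y := by
    filter_upwards [extChartAt_target_mem_nhdsWithin x] with y hy
    exact localRep_extD hθ hy
  have hr : extChartAt I x x ∈ range I := mem_range_self _
  have hc : ContDiffWithinAt ℝ ∞ (localRep I θ x) (range I) (extChartAt I x x) :=
    ((hθ x) _ (mem_extChartAt_target x)).mono_of_mem_nhdsWithin
      (extChartAt_target_mem_nhdsWithin x)
  rw [Filter.EventuallyEq.extDerivWithin_eq_of_mem h hr, extDerivWithin_extDerivWithin_apply hc
    minSmoothness_two_le I.uniqueDiffOn (I.range_subset_closure_interior hr) hr]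
  rfl

end Charts

/-! ### Charts of the cone -/

/-- Smoothness of a function with values in the alternating maps on a finite-dimensional space
can be checked on constant arguments. -/
theorem contDiffOn_alternatingMap {V W : Type*} [NormedAddCommGroup V] [NormedSpace ℝ V]
    [NormedAddCommGroup W] [NormedSpace ℝ W] [FiniteDimensional ℝ W] {k : ℕ} {m : WithTop ℕ∞}
    {s : Set V} {α : V → W [⋀^Fin k]→L[ℝ] ℂ} (h : ∀ w, ContDiffOn ℝ m (fun y ↦ α y w) s) :
    ContDiffOn ℝ m α s := by
  let b := Module.finBasis ℝ W
  let Φ : (W [⋀^Fin k]→L[ℝ] ℂ) →ₗ[ℝ] ((Fin k → Fin (Module.finrank ℝ W)) → ℂ) :=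
    { toFun := fun β s ↦ β fun i ↦ b (s i)
      map_add' := fun _ _ ↦ rfl
      map_smul' := fun _ _ ↦ rfl }
  have hΦ : LinearMap.ker Φ = ⊥ := by
    refine LinearMap.ker_eq_bot'.2 fun β hβ ↦ ?_
    refine ContinuousAlternatingMap.toAlternatingMap_injective ?_
    exact b.ext_alternating fun s _ ↦ congrFun hβ s
  obtain ⟨Ψ, hΨ⟩ := Φ.exists_leftInverse_of_injective hΦ
  have h1 : ContDiffOn ℝ m (fun y ↦ Φ (α y)) s := contDiffOn_pi.2 fun s ↦ h _
  refine ((LinearMap.toContinuousLinearMap Ψ).contDiff.comp_contDiffOn h1).congr fun y _ ↦ ?_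
  exact (LinearMap.congr_fun hΨ (α y)).symm

section ConeCharts

variable {n : ℕ} {M : Type*} [TopologicalSpace M] [ChartedSpace (EuclideanSpace ℝ (Fin n)) M]

theorem extChartAt_cone (q : HalfLine × M) :
    extChartAt (coneModel n) q = halfLineModel.toPartialEquiv.prod (extChartAt (𝓡 n) q.2) := by
  rw [extChartAt_prod]
  congr 1
  simp only [extChartAt, OpenPartialHomeomorph.extend, chartAt_self_eq,
    OpenPartialHomeomorph.refl_partialEquiv, PartialEquiv.refl_trans]

theorem extChartAt_cone_apply (q q' : HalfLine × M) :
    extChartAt (coneModel n) q q' = ((q'.1 : ℝ), extChartAt (𝓡 n) q.2 q'.2) :=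
  rfl

theorem extChartAt_cone_symm_apply (q : HalfLine × M) (r : HalfLine)
    (x : EuclideanSpace ℝ (Fin n)) :
    (extChartAt (coneModel n) q).symm ((r : ℝ), x) = (r, (extChartAt (𝓡 n) q.2).symm x) :=
  Prod.ext (Set.projIci_coe r) rfl

theorem extChartAt_cone_target (q : HalfLine × M) :
    (extChartAt (coneModel n) q).target = Set.Ici 0 ×ˢ (extChartAt (𝓡 n) q.2).target := by
  rw [extChartAt_cone]
  rfl

variable [IsManifold (𝓡 n) ∞ M]

theorem mfderivWithin_extChartAt_cone_symm (q : HalfLine × M) (r : HalfLine)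
    {x : EuclideanSpace ℝ (Fin n)} (hx : x ∈ (extChartAt (𝓡 n) q.2).target)
    (w : ℝ × EuclideanSpace ℝ (Fin n)) :
    mfderivWithin 𝓘(ℝ, ℝ × EuclideanSpace ℝ (Fin n)) (coneModel n)
      (extChartAt (coneModel n) q).symm (range (coneModel n)) ((r : ℝ), x) w
    = (w.1, mfderivWithin 𝓘(ℝ, EuclideanSpace ℝ (Fin n)) (𝓡 n)
      (extChartAt (𝓡 n) q.2).symm (range (𝓡 n)) x w.2) := by
  have : IsManifold (𝓡 n) 1 M := IsManifold.of_le (n := ∞) (by simp)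
  have h1 : MDifferentiableWithinAt 𝓘(ℝ, ℝ) halfLineModel (extChartAt halfLineModel r).symm
      (range halfLineModel) (r : ℝ) :=
    mdifferentiableWithinAt_extChartAt_symm (mem_extChartAt_target (I := halfLineModel) r)
  have h2 : MDifferentiableWithinAt 𝓘(ℝ, EuclideanSpace ℝ (Fin n)) (𝓡 n)
      (extChartAt (𝓡 n) q.2).symm (range (𝓡 n)) x := mdifferentiableWithinAt_extChartAt_symm hx
  have hu1 : UniqueMDiffWithinAt 𝓘(ℝ, ℝ) (range halfLineModel) (r : ℝ) :=
    (halfLineModel.uniqueDiffOn _ (mem_range_self r)).uniqueMDiffWithinAt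
  have hu2 : UniqueMDiffWithinAt 𝓘(ℝ, EuclideanSpace ℝ (Fin n)) (range (𝓡 n)) x :=
    ((𝓡 n).uniqueDiffOn _ (extChartAt_target_subset_range q.2 hx)).uniqueMDiffWithinAt
  have h3 := mfderivWithin_prodMap (p := ((r : ℝ), x)) h1 h2 hu1 hu2
  rw [modelWithCornersSelf_prod, ← chartedSpaceSelf_prod, coneModel,
    ModelWithCorners.range_prod]
  have h4 : mfderivWithin 𝓘(ℝ, ℝ) halfLineModel (extChartAt halfLineModel r).symm
      (range halfLineModel) (r : ℝ) = ContinuousLinearMap.id ℝ _ :=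
    mfderivWithin_range_extChartAt_symm (I := halfLineModel) (x := r)
  have h5 := DFunLike.congr_fun h3 w
  refine h5.trans ?_
  refine Prod.ext ?_ rfl
  exact DFunLike.congr_fun h4 w.1

theorem localRep_cone_apply {k : ℕ} (θ : FormField (coneModel n) (HalfLine × M) k)
    (q : HalfLine × M) (r : HalfLine) {x : EuclideanSpace ℝ (Fin n)}
    (hx : x ∈ (extChartAt (𝓡 n) q.2).target) (w : Fin k → ℝ × EuclideanSpace ℝ (Fin n)) :
    localRep (coneModel n) θ q ((r : ℝ), x) w
    = (show (ℝ × EuclideanSpace ℝ (Fin n)) [⋀^Fin k]→L[ℝ] ℂ from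
        θ (r, (extChartAt (𝓡 n) q.2).symm x))
      fun i ↦ ((w i).1, mfderivWithin 𝓘(ℝ, EuclideanSpace ℝ (Fin n)) (𝓡 n)
        (extChartAt (𝓡 n) q.2).symm (range (𝓡 n)) x (w i).2) := by
  rw [localRep_apply]
  refine (θ.apply_congr (extChartAt_cone_symm_apply q r x) _).trans ?_
  congr 1
  funext i
  exact mfderivWithin_extChartAt_cone_symm q r hx (w i)

theorem localRep_cone_self {k : ℕ} (θ : FormField (coneModel n) (HalfLine × M) k)
    (r r₀ : HalfLine) (p : M) (w : Fin k → ℝ × EuclideanSpace ℝ (Fin n)) :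
    localRep (coneModel n) θ (r₀, p) ((r : ℝ), extChartAt (𝓡 n) p p) w = θ (r, p) w := by
  have : IsManifold (coneModel n) 1 (HalfLine × M) := IsManifold.of_le (n := ∞) (by simp)
  rw [← localRep_self (coneModel n) θ (r, p) w, extChartAt_cone_apply]
  rw [localRep_cone_apply θ (r₀, p) r (mem_extChartAt_target p)]
  exact (localRep_cone_apply θ (r, p) r (mem_extChartAt_target p) w).symm

end ConeCharts

/-! ### Forms on the cone and their coefficients in the coefficient space -/

namespace CoefficientSpace

section Coefficients

variable {n : ℕ} {M : Type*} [TopologicalSpace M] [ChartedSpace (EuclideanSpace ℝ (Fin n)) M]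
  {F : Type*} [AddCommGroup F] [Module ℂ F] [UniformSpace F] (A : CoefficientSpace F)

/-- The coefficient of `θ` on the constant vector fields `w` in the chart at `p₀`, as a map to `𝒜`.
This has a meaning only where this coefficient does define an element of `𝒜`. -/
def coeff {k : ℕ} (θ : FormField (coneModel n) (HalfLine × M) k) (p₀ : M)
    (w : Fin k → ℝ × EuclideanSpace ℝ (Fin n)) : EuclideanSpace ℝ (Fin n) → F := fun x ↦
  Function.invFun A.incl fun r ↦
    localRep (coneModel n) θ (⟨0, Set.self_mem_Ici⟩, p₀) ((r : ℝ), x) w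

variable {A}

theorem coeff_eq {k : ℕ} {θ : FormField (coneModel n) (HalfLine × M) k} {p₀ : M}
    {w : Fin k → ℝ × EuclideanSpace ℝ (Fin n)} {x : EuclideanSpace ℝ (Fin n)} {a : F}
    (h : ∀ r : HalfLine, A.incl a r
      = localRep (coneModel n) θ (⟨0, Set.self_mem_Ici⟩, p₀) ((r : ℝ), x) w) :
    A.coeff θ p₀ w x = a := by
  rw [coeff, ← funext h]
  exact Function.leftInverse_invFun A.incl_injective a

variable {k : ℕ} {θ : FormField (coneModel n) (HalfLine × M) k}

theorem localRep_eq_zero [IsManifold (𝓡 n) ∞ M] {ε : ℝ}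
    (hθ : ∀ (r : HalfLine) (p : M), (r : ℝ) < ε → θ (r, p) = 0)
    (q : HalfLine × M) {r : HalfLine} (hr : (r : ℝ) < ε) {x : EuclideanSpace ℝ (Fin n)}
    (hx : x ∈ (extChartAt (𝓡 n) q.2).target) (w : Fin k → ℝ × EuclideanSpace ℝ (Fin n)) :
    localRep (coneModel n) θ q ((r : ℝ), x) w = 0 := by
  rw [localRep_cone_apply θ q r hx, hθ _ _ hr]
  rfl

/-- The representation of a form on the cone in the chart at `(r₀, p₀)` does not depend on `r₀`. -/
theorem localRep_eq_uncurry [IsManifold (𝓡 n) ∞ M] (q : HalfLine × M)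
    {w : Fin k → ℝ × EuclideanSpace ℝ (Fin n)}
    {g : EuclideanSpace ℝ (Fin n) → F}
    (hg : ∀ x ∈ (extChartAt (𝓡 n) q.2).target, ∀ r : HalfLine, A.incl (g x) r
      = localRep (coneModel n) θ (⟨0, Set.self_mem_Ici⟩, q.2) ((r : ℝ), x) w) :
    ∀ y ∈ (extChartAt (coneModel n) q).target,
      localRep (coneModel n) θ q y w = A.uncurry g y := by
  rintro ⟨r, x⟩ hy
  rw [extChartAt_cone_target] at hy
  lift r to HalfLine using hy.1
  rw [uncurry_apply, hg x hy.2]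
  exact (localRep_cone_apply θ q r hy.2 w).trans (localRep_cone_apply θ (_, q.2) r hy.2 w).symm

variable [IsUniformAddGroup F] [ContinuousSMul ℂ F]

theorem incl_coeff (hθ : θ ∈ A.forms n M k) {p₀ : M} (w : Fin k → ℝ × EuclideanSpace ℝ (Fin n))
    {x : EuclideanSpace ℝ (Fin n)} (hx : x ∈ (extChartAt (𝓡 n) p₀).target) (r : HalfLine) :
    A.incl (A.coeff θ p₀ w x) r
      = localRep (coneModel n) θ (⟨0, Set.self_mem_Ici⟩, p₀) ((r : ℝ), x) w := by
  obtain ⟨g, -, hg⟩ := hθ.2.2 p₀ w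
  rw [coeff_eq (hg x hx), hg x hx]

theorem isSmoothOn_coeff (hθ : θ ∈ A.forms n M k) (p₀ : M)
    (w : Fin k → ℝ × EuclideanSpace ℝ (Fin n)) :
    IsSmoothOn (extChartAt (𝓡 n) p₀).target (A.coeff θ p₀ w) := by
  obtain ⟨g, hgs, hg⟩ := hθ.2.2 p₀ w
  exact hgs.congr (isOpen_extChartAt_target p₀) fun x hx ↦ coeff_eq (hg x hx)

variable [IsManifold (𝓡 n) ∞ M]

theorem exists_coeff_mem_vanishing (hθ : θ ∈ A.forms n M k) : ∃ ε : ℝ, 0 < ε ∧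
    ∀ p₀ w, MapsTo (A.coeff θ p₀ w) (extChartAt (𝓡 n) p₀).target (A.vanishing ε) := by
  obtain ⟨ε, hε, h⟩ := hθ.2.1
  refine ⟨ε, hε, fun p₀ w x hx r hr ↦ ?_⟩
  rw [incl_coeff hθ w hx]
  exact localRep_eq_zero h (_, p₀) hr hx w

variable [CompleteSpace F] [T2Space F] [(uniformity F).IsCountablyGenerated]

/-- A form which vanishes near `r = 0` belongs to `Ω^k 𝒜₀` as soon as its coefficients are smooth
maps to `𝒜`: its smoothness is then automatic. -/
theorem mem_forms (hθ : ∃ ε : ℝ, 0 < ε ∧ ∀ (r : HalfLine) (p : M), (r : ℝ) < ε → θ (r, p) = 0)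
    (h : ∀ (p₀ : M) (w : Fin k → ℝ × EuclideanSpace ℝ (Fin n)),
      A.IsSmoothFamily (extChartAt (𝓡 n) p₀).target fun r x ↦
        localRep (coneModel n) θ (⟨0, Set.self_mem_Ici⟩, p₀) ((r : ℝ), x) w) :
    θ ∈ A.forms n M k := by
  refine ⟨fun q ↦ contDiffOn_alternatingMap fun w ↦ ?_, hθ, h⟩
  obtain ⟨ε, hε, hθε⟩ := hθ
  obtain ⟨g, hgs, hg⟩ := h q.2 w
  refine ((A.contDiffOn_uncurry hε (isOpen_extChartAt_target q.2) hgs fun x hx r hr ↦ ?_).mono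
    ?_).congr (localRep_eq_uncurry q hg)
  · rw [hg x hx]
    exact localRep_eq_zero hθε (_, q.2) hr hx w
  · rw [extChartAt_cone_target]
    exact prod_mono (subset_univ _) subset_rfl

/-- The coefficients of the exterior derivative of a form in `Ω^k 𝒜₀`. -/
theorem localRep_extD_cone (hθ : θ ∈ A.forms n M k) (q : HalfLine × M)
    (w : Fin (k + 1) → ℝ × EuclideanSpace ℝ (Fin n))
    {g' : Fin (k + 1) → EuclideanSpace ℝ (Fin n) → F}
    (hg' : ∀ i, IsDirDeriv (extChartAt (𝓡 n) q.2).target (w i).2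
      (A.coeff θ q.2 (i.removeNth w)) (g' i))
    {x : EuclideanSpace ℝ (Fin n)} (hx : x ∈ (extChartAt (𝓡 n) q.2).target) (r : HalfLine) :
    localRep (coneModel n) (extD (coneModel n) θ) q ((r : ℝ), x) w
      = A.incl (∑ i : Fin (k + 1), (-1) ^ (i : ℕ) •
        ((w i).1 • A.derivative (A.coeff θ q.2 (i.removeNth w) x) + g' i x)) r := by
  obtain ⟨ε, hε, hv⟩ := exists_coeff_mem_vanishing hθ
  have hy : ((r : ℝ), x) ∈ (extChartAt (coneModel n) q).target := by
    rw [extChartAt_cone_target]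
    exact ⟨r.2, hx⟩
  have hu : UniqueDiffWithinAt ℝ (range (coneModel n)) ((r : ℝ), x) :=
    (coneModel n).uniqueDiffOn _ (extChartAt_target_subset_range q hy)
  have hd : DifferentiableWithinAt ℝ (localRep (coneModel n) θ q) (range (coneModel n))
      ((r : ℝ), x) :=
    ((hθ.1 q _ hy).differentiableWithinAt (by simp)).mono_of_mem_nhdsWithin
      (extChartAt_target_mem_nhdsWithin_of_mem hy)
  rw [localRep_extD hθ.1 hy, extDerivWithin_apply hd hu, map_sum, Finset.sum_apply]
  refine Finset.sum_congr rfl fun i _ ↦ ?_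
  rw [map_zsmul, Pi.smul_apply]
  congr 1
  have hcongr : ∀ᶠ y in 𝓝[range (coneModel n)] ((r : ℝ), x),
      localRep (coneModel n) θ q y (i.removeNth w)
        = A.uncurry (A.coeff θ q.2 (i.removeNth w)) y := by
    filter_upwards [extChartAt_target_mem_nhdsWithin_of_mem hy]
    exact localRep_eq_uncurry q fun x hx r ↦ incl_coeff hθ _ hx r
  have ho := isOpen_extChartAt_target (I := 𝓡 n) q.2
  have hs := isSmoothOn_coeff hθ q.2 (i.removeNth w)
  rw [Filter.EventuallyEq.fderivWithin_eq_of_mem hcongr (extChartAt_target_subset_range q hy),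
    (A.differentiableAt_uncurry hε ho hs (hv _ _) hx).fderivWithin hu,
    A.fderiv_uncurry hε ho hs (hv _ _) hx (hg' i), uncurry_apply]

theorem extD_mem_forms (hθ : θ ∈ A.forms n M k) :
    extD (coneModel n) θ ∈ A.forms n M (k + 1) := by
  have hT := isOpen_extChartAt_target (I := 𝓡 n) (M := M)
  refine mem_forms ?_ fun p₀ w ↦ ?_
  · obtain ⟨ε, hε, h⟩ := hθ.2.1
    refine ⟨ε, hε, fun r p hr ↦ ?_⟩
    suffices h0 : ∀ w : Fin (k + 1) → ℝ × EuclideanSpace ℝ (Fin n),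
        extD (coneModel n) θ (r, p) w = 0 from ContinuousAlternatingMap.ext h0
    intro w
    have hε' : ∀ p₀ w, MapsTo (A.coeff θ p₀ w) (extChartAt (𝓡 n) p₀).target (A.vanishing ε) :=
      fun p₀ w x hx r hr ↦ by
        rw [incl_coeff hθ w hx]
        exact localRep_eq_zero h (_, p₀) hr hx w
    choose g' hg' hs using fun i : Fin (k + 1) ↦
      (isSmoothOn_coeff hθ p (i.removeNth w)).exists_isDirDeriv (hT p) (w i).2
    rw [← localRep_cone_self _ _ r, localRep_extD_cone hθ (r, p) w hg' (mem_extChartAt_target p)]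
    have hmem : ∑ i : Fin (k + 1), (-1) ^ (i : ℕ) • ((w i).1 • A.derivative
        (A.coeff θ p (i.removeNth w) (extChartAt (𝓡 n) p p)) + g' i (extChartAt (𝓡 n) p p))
        ∈ A.vanishing ε := by
      refine Submodule.sum_mem _ fun i _ ↦ zsmul_mem (Submodule.add_mem _ ?_ ?_) _
      · exact ((A.vanishing ε).restrictScalars ℝ).smul_mem _
          (derivative_mem_vanishing hε (hε' p _ (mem_extChartAt_target p)))
      · exact (hg' i).mem (hT p) (S := (A.vanishing ε).restrictScalars ℝ)
          (A.isClosed_vanishing ε) (hε' p _) (mem_extChartAt_target p)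
    exact hmem r hr
  · choose g' hg' hs using fun i : Fin (k + 1) ↦
      (isSmoothOn_coeff hθ p₀ (i.removeNth w)).exists_isDirDeriv (hT p₀) (w i).2
    refine ⟨_, ?_, fun x hx r ↦ (localRep_extD_cone hθ (_, p₀) w hg' hx r).symm⟩
    refine IsSmoothOn.sum fun i _ ↦ ?_
    have h1 := isSmoothOn_derivative (A := A) (hT p₀) (isSmoothOn_coeff hθ p₀ (i.removeNth w))
    have h2 := ((h1.const_smul (((w i).1 : ℝ) : ℂ)).add (hs i)).const_smul
      (((-1) ^ (i : ℕ) : ℤ) : ℂ)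
    simpa only [Int.cast_smul_eq_zsmul, Complex.coe_smul] using! h2

end Coefficients

end CoefficientSpace

/-! ### Integration along the fiber is a morphism of complexes -/

/-- The tangent vectors `v₁, …, v_k, ∂_r` of the cone, for vectors `v₁, …, v_k` tangent to the
base. -/
def withRadial {V : Type*} [Zero V] {k : ℕ} (v : Fin k → V) : Fin (k + 1) → ℝ × V :=
  Fin.snoc (α := fun _ ↦ ℝ × V) (fun i ↦ (0, v i)) (1, 0)

section WithRadial

variable {V : Type*} [Zero V] {k : ℕ}

@[simp]
theorem withRadial_castSucc (v : Fin k → V) (i : Fin k) : withRadial v i.castSucc = (0, v i) :=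
  Fin.snoc_castSucc ..

@[simp]
theorem withRadial_last (v : Fin k → V) : withRadial v (Fin.last k) = (1, 0) :=
  Fin.snoc_last ..

theorem removeNth_castSucc_withRadial (v : Fin (k + 1) → V) (i : Fin (k + 1)) :
    i.castSucc.removeNth (withRadial v) = withRadial (i.removeNth v) := by
  funext j
  rw [Fin.removeNth]
  induction j using Fin.lastCases with
  | last => rw [withRadial_last, Fin.succAbove_castSucc_of_le _ _ (Fin.le_last _), Fin.succ_last,
      withRadial_last]
  | cast j => rw [withRadial_castSucc, Fin.castSucc_succAbove_castSucc, withRadial_castSucc,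
      Fin.removeNth]

theorem removeNth_last_withRadial (v : Fin k → V) :
    (Fin.last k).removeNth (withRadial v) = fun i ↦ (0, v i) := by
  funext j
  rw [Fin.removeNth, Fin.succAbove_last, withRadial_castSucc]

end WithRadial

namespace CoefficientSpace

variable {n : ℕ} {M : Type*} [TopologicalSpace M] [ChartedSpace (EuclideanSpace ℝ (Fin n)) M]
  [IsManifold (𝓡 n) ∞ M] {F : Type*} [AddCommGroup F] [Module ℂ F]

theorem integral_eq [TopologicalSpace F] (A : CoefficientSpace F) (f : LinearMap.range A.incl)
    {a : F} (h : A.incl a = f) : A.integral f = A.reg a := by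
  have : LinearEquiv.ofInjective A.incl A.incl_injective a = f := Subtype.ext h
  rw [← this, integral, LinearMap.comp_apply]
  exact congrArg A.reg (LinearEquiv.symm_apply_apply _ a)

variable [UniformSpace F] [IsUniformAddGroup F] [ContinuousSMul ℂ F] (A : CoefficientSpace F)
  {k : ℕ}

theorem localRep_withRadial (θ : FormField (coneModel n) (HalfLine × M) (k + 1)) (q : HalfLine × M)
    (r : HalfLine) {x : EuclideanSpace ℝ (Fin n)} (hx : x ∈ (extChartAt (𝓡 n) q.2).target)
    (v : Fin k → EuclideanSpace ℝ (Fin n)) :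
    localRep (coneModel n) θ q ((r : ℝ), x) (withRadial v)
      = fiberCoeff θ ((extChartAt (𝓡 n) q.2).symm x) (fun i ↦
        mfderivWithin 𝓘(ℝ, EuclideanSpace ℝ (Fin n)) (𝓡 n)
          (extChartAt (𝓡 n) q.2).symm (range (𝓡 n)) x (v i)) r := by
  rw [localRep_cone_apply θ q r hx]
  refine congrArg (show (ℝ × EuclideanSpace ℝ (Fin n)) [⋀^Fin (k + 1)]→L[ℝ] ℂ from
    θ (r, (extChartAt (𝓡 n) q.2).symm x)) (funext fun i ↦ ?_)
  induction i using Fin.lastCases with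
  | last =>
    rw [withRadial_last, Fin.snoc_last]
    exact Prod.ext rfl (map_zero _)
  | cast j =>
    rw [withRadial_castSucc, Fin.snoc_castSucc]

theorem localRep_fiberIntegral (θ : A.forms n M (k + 1)) {p₀ : M} {x : EuclideanSpace ℝ (Fin n)}
    (hx : x ∈ (extChartAt (𝓡 n) p₀).target) (v : Fin k → EuclideanSpace ℝ (Fin n)) :
    localRep (𝓡 n) (A.fiberIntegral M k θ) p₀ x v
      = A.reg (A.coeff θ.1 p₀ (withRadial v) x) := by
  rw [localRep_apply]
  refine A.integral_eq _ (funext fun r ↦ ?_)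
  rw [incl_coeff θ.2 _ hx]
  exact localRep_withRadial θ.1 (_, p₀) r hx v

variable [CompleteSpace F] [T2Space F] [(uniformity F).IsCountablyGenerated]

theorem isSmoothOn_reg_coeff {θ : FormField (coneModel n) (HalfLine × M) k}
    (hθ : θ ∈ A.forms n M k) (p₀ : M) (w : Fin k → ℝ × EuclideanSpace ℝ (Fin n)) :
    IsSmoothOn (extChartAt (𝓡 n) p₀).target (fun x ↦ A.reg (A.coeff θ p₀ w x)) := by
  obtain ⟨ε, hε, hv⟩ := exists_coeff_mem_vanishing hθ
  exact (isSmoothOn_coeff hθ p₀ w).map (isOpen_extChartAt_target p₀)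
    (L := A.reg.restrictScalars ℝ) (S := (A.vanishing ε).restrictScalars ℝ)
    (A.isClosed_vanishing ε) (A.exists_primitive hε).1 (hv p₀ w)

theorem fderiv_reg_coeff {θ : FormField (coneModel n) (HalfLine × M) k}
    (hθ : θ ∈ A.forms n M k) {p₀ : M} {w : Fin k → ℝ × EuclideanSpace ℝ (Fin n)}
    {v : EuclideanSpace ℝ (Fin n)} {g' : EuclideanSpace ℝ (Fin n) → F}
    (hg' : IsDirDeriv (extChartAt (𝓡 n) p₀).target v (A.coeff θ p₀ w) g')
    {x : EuclideanSpace ℝ (Fin n)} (hx : x ∈ (extChartAt (𝓡 n) p₀).target) :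
    fderiv ℝ (fun x ↦ A.reg (A.coeff θ p₀ w x)) x v = A.reg (g' x) := by
  have ho := isOpen_extChartAt_target (I := 𝓡 n) p₀
  obtain ⟨ε, hε, hv⟩ := exists_coeff_mem_vanishing hθ
  have hd : DifferentiableAt ℝ (fun x ↦ A.reg (A.coeff θ p₀ w x)) x :=
    (((A.isSmoothOn_reg_coeff hθ p₀ w).contDiffOn ho).contDiffAt
      (ho.mem_nhds hx)).differentiableAt (by simp)
  have h1 := hg'.map ho (L := A.reg.restrictScalars ℝ) (S := (A.vanishing ε).restrictScalars ℝ)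
    (A.isClosed_vanishing ε) (hv p₀ w) (A.exists_primitive hε).1
  rw [← hd.lineDeriv_eq_fderiv]
  exact (hasLineDerivAt_of_tendsto (h1 x hx)).lineDeriv

theorem fiberIntegral_mem_smoothForms (θ : A.forms n M (k + 1)) :
    A.fiberIntegral M k θ ∈ smoothForms (𝓡 n) M k := by
  intro p₀
  refine contDiffOn_alternatingMap fun v ↦ ?_
  refine ((A.isSmoothOn_reg_coeff θ.2 p₀ (withRadial v)).contDiffOn
    (isOpen_extChartAt_target p₀)).congr fun x hx ↦ ?_
  exact A.localRep_fiberIntegral θ hx v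

/-- The regularized integral of `dθ` along the fiber. The derivatives in the direction of `r` do not
contribute to it, since the regularized integral vanishes on derivatives. -/
theorem localRep_fiberIntegral_extD {θ : FormField (coneModel n) (HalfLine × M) k}
    (hθ : θ ∈ A.forms n M k) (h : extD (coneModel n) θ ∈ A.forms n M (k + 1)) {p₀ : M}
    (v : Fin k → EuclideanSpace ℝ (Fin n)) {g' : Fin (k + 1) → EuclideanSpace ℝ (Fin n) → F}
    (hg' : ∀ i, IsDirDeriv (extChartAt (𝓡 n) p₀).target (withRadial v i).2
      (A.coeff θ p₀ (i.removeNth (withRadial v))) (g' i))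
    {x : EuclideanSpace ℝ (Fin n)} (hx : x ∈ (extChartAt (𝓡 n) p₀).target) :
    localRep (𝓡 n) (A.fiberIntegral M k ⟨extD (coneModel n) θ, h⟩) p₀ x v
      = ∑ i : Fin (k + 1), (-1) ^ (i : ℕ) • A.reg (g' i x) := by
  obtain ⟨ε, hε, hv⟩ := exists_coeff_mem_vanishing hθ
  rw [localRep_fiberIntegral _ _ hx,
    coeff_eq fun r ↦ (localRep_extD_cone hθ (_, p₀) (withRadial v) hg' hx r).symm, map_sum]
  refine Finset.sum_congr rfl fun i _ ↦ ?_
  have h1 := A.reg.map_smul_of_tower (withRadial v i).1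
    (A.derivative (A.coeff θ p₀ (i.removeNth (withRadial v)) x))
  rw [map_zsmul, map_add, h1, reg_derivative hε (hv _ _ hx), smul_zero, zero_add]

theorem fiberIntegral_extD_zero (θ : A.forms n M 0) (h : extD (coneModel n) θ.1 ∈ A.forms n M 1) :
    A.fiberIntegral M 0 ⟨extD (coneModel n) θ.1, h⟩ = 0 := by
  have : IsManifold (𝓡 n) 1 M := IsManifold.of_le (n := ∞) (by simp)
  funext p
  suffices h0 : ∀ v : Fin 0 → EuclideanSpace ℝ (Fin n),
      A.fiberIntegral M 0 ⟨extD (coneModel n) θ.1, h⟩ p v = 0 from ContinuousAlternatingMap.ext h0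
  intro v
  rw [← localRep_self (𝓡 n), A.localRep_fiberIntegral_extD θ.2 h v (g' := fun _ _ ↦ 0) _
    (mem_extChartAt_target p)]
  · simp
  · intro i x _
    obtain rfl : i = Fin.last 0 := Fin.ext (Nat.lt_one_iff.1 i.2)
    rw [withRadial_last]
    simp

theorem fiberIntegral_extD (θ : A.forms n M (k + 1))
    (h : extD (coneModel n) θ.1 ∈ A.forms n M (k + 2)) :
    A.fiberIntegral M (k + 1) ⟨extD (coneModel n) θ.1, h⟩
      = extD (𝓡 n) (A.fiberIntegral M k θ) := by
  have : IsManifold (𝓡 n) 1 M := IsManifold.of_le (n := ∞) (by simp)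
  funext p
  have ho := isOpen_extChartAt_target (I := 𝓡 n) p
  have hx := mem_extChartAt_target (I := 𝓡 n) p
  suffices h0 : ∀ v : Fin (k + 1) → EuclideanSpace ℝ (Fin n),
      A.fiberIntegral M (k + 1) ⟨extD (coneModel n) θ.1, h⟩ p v
        = extD (𝓡 n) (A.fiberIntegral M k θ) p v from ContinuousAlternatingMap.ext h0
  intro v
  choose g' hg' using fun i ↦ (isSmoothOn_coeff θ.2 p
    (i.removeNth (withRadial v))).exists_isDirDeriv ho (withRadial v i).2
  have hlast : g' (Fin.last (k + 1)) (extChartAt (𝓡 n) p p) = 0 := by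
    have h1 := (hg' (Fin.last (k + 1))).1 _ hx
    rw [withRadial_last] at h1
    exact tendsto_nhds_unique h1 (by simp)
  rw [← localRep_self (𝓡 n), A.localRep_fiberIntegral_extD θ.2 h v (fun i ↦ (hg' i).1) hx,
    Fin.sum_univ_castSucc, hlast, map_zero, smul_zero, add_zero, extDerivWithin_range_eq_extD,
    extDerivWithin_apply
      (differentiableWithinAt_localRep (𝓡 n) (A.fiberIntegral_mem_smoothForms θ) p)
      ((𝓡 n).uniqueDiffOn _ (mem_range_self _))]
  refine Finset.sum_congr rfl fun i _ ↦ ?_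
  rw [Fin.val_castSucc]
  congr 1
  have hd := (hg' i.castSucc).1
  rw [withRadial_castSucc, removeNth_castSucc_withRadial] at hd
  rw [ModelWithCorners.range_eq_univ, fderivWithin_univ, ← A.fderiv_reg_coeff θ.2 hd hx]
  refine congrArg (fun L : EuclideanSpace ℝ (Fin n) →L[ℝ] ℂ ↦ L (v i))
    (Filter.EventuallyEq.fderiv_eq ?_)
  filter_upwards [ho.mem_nhds hx] with x hx
  exact (A.localRep_fiberIntegral θ hx _).symm

end CoefficientSpace

/-! ### Forms without radial part -/

section Radial

variable {V : Type*} [NormedAddCommGroup V] [NormedSpace ℝ V]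

/-- An alternating map on `ℝ × V` vanishes if it vanishes on vectors in `V`, and on tuples of
one vector `∂_r` and vectors in `V`. -/
theorem alternatingMap_eq_zero_of_prod [FiniteDimensional ℝ V] {k : ℕ}
    (α : (ℝ × V) [⋀^Fin k]→ₗ[ℝ] ℂ) (h0 : ∀ v : Fin k → V, α (fun i ↦ (0, v i)) = 0)
    (h1 : ∀ (w : Fin k → ℝ × V) (i : Fin k), w i = (1, 0) → (∀ j, j ≠ i → (w j).1 = 0) → α w = 0) :
    α = 0 := by
  let b := (Module.Basis.singleton Unit ℝ).prod (Module.finBasis ℝ V)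
  have hl : ∀ u, b (Sum.inl u) = (1, 0) := fun u ↦ by simp [b]
  have hr : ∀ j, b (Sum.inr j) = (0, Module.finBasis ℝ V j) := fun j ↦ by simp [b]
  refine b.ext_alternating fun s hs ↦ ?_
  rw [AlternatingMap.zero_apply]
  by_cases h : ∃ i, s i = Sum.inl ()
  · obtain ⟨i, hi⟩ := h
    refine h1 _ i (by rw [hi, hl]) fun j hj ↦ ?_
    rcases hsj : s j with u | l
    · exact absurd (hs (hsj.trans hi.symm)) hj
    · rw [hr]
  · have h2 : ∀ j, b (s j) = (0, (b (s j)).2) := fun j ↦ by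
      rcases hsj : s j with u | l
      · exact absurd ⟨j, hsj⟩ h
      · rw [hr]
    have := h0 fun j ↦ (b (s j)).2
    rwa [← funext h2] at this

theorem alternatingMap_eq_zero_of_withRadial {k : ℕ} (α : (ℝ × V) [⋀^Fin (k + 1)]→ₗ[ℝ] ℂ)
    (h : ∀ v : Fin k → V, α (withRadial v) = 0) {w : Fin (k + 1) → ℝ × V} {i : Fin (k + 1)}
    (hi : w i = (1, 0)) (hw : ∀ j, j ≠ i → (w j).1 = 0) : α w = 0 := by
  have hs : w ∘ Equiv.swap i (Fin.last k)
      = withRadial fun j ↦ (w (Equiv.swap i (Fin.last k) j.castSucc)).2 := by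
    funext j
    induction j using Fin.lastCases with
    | last => rw [withRadial_last, Function.comp_apply, Equiv.swap_apply_right, hi]
    | cast j =>
      rw [withRadial_castSucc, Function.comp_apply]
      refine Prod.ext (hw _ fun hji ↦ ?_) rfl
      rw [Equiv.swap_apply_eq_iff, Equiv.swap_apply_left] at hji
      exact (Fin.castSucc_lt_last j).ne hji
  have h1 := α.map_perm w (Equiv.swap i (Fin.last k))
  rw [hs, h] at h1
  exact (smul_eq_zero_iff_eq _).1 h1.symm

end Radial

variable {n : ℕ} {M : Type*} [TopologicalSpace M] [ChartedSpace (EuclideanSpace ℝ (Fin n)) M]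

/-- A form on the cone has no radial part if it has no component containing `dr`. This is required
only for tuples of one vector `∂_r` and vectors tangent to the base, which determine the other
components. -/
def HasNoRadialPart {k : ℕ} (θ : FormField (coneModel n) (HalfLine × M) k) : Prop :=
  ∀ (r : HalfLine) (p : M) (w : Fin k → ℝ × EuclideanSpace ℝ (Fin n)) (i : Fin k),
    w i = (1, 0) → (∀ j, j ≠ i → (w j).1 = 0) → θ (r, p) w = 0

theorem hasNoRadialPart_of_withRadial {k : ℕ}
    {θ : FormField (coneModel n) (HalfLine × M) (k + 1)}
    (h : ∀ (r : HalfLine) (p : M) (v : Fin k → EuclideanSpace ℝ (Fin n)),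
      θ (r, p) (withRadial v) = 0) : HasNoRadialPart θ := fun r p _ _ hi hw ↦
  alternatingMap_eq_zero_of_withRadial
    (show (ℝ × EuclideanSpace ℝ (Fin n)) [⋀^Fin (k + 1)]→L[ℝ] ℂ from θ (r, p)).toAlternatingMap
    (h r p) hi hw

namespace CoefficientSpace

variable [IsManifold (𝓡 n) ∞ M] {F : Type*} [AddCommGroup F] [Module ℂ F]
  [UniformSpace F] {A : CoefficientSpace F}
  {k : ℕ} {θ : FormField (coneModel n) (HalfLine × M) k}

theorem coeff_eq_zero_of_hasNoRadialPart (h : HasNoRadialPart θ)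
    {p₀ : M} {w : Fin k → ℝ × EuclideanSpace ℝ (Fin n)} {i : Fin k} (hi : w i = (1, 0))
    (hw : ∀ j, j ≠ i → (w j).1 = 0) {x : EuclideanSpace ℝ (Fin n)}
    (hx : x ∈ (extChartAt (𝓡 n) p₀).target) : A.coeff θ p₀ w x = 0 := by
  refine coeff_eq fun r ↦ ?_
  rw [map_zero, Pi.zero_apply, localRep_cone_apply θ (_, p₀) r hx]
  refine Eq.symm (h r _ _ i ?_ ?_)
  · rw [hi]
    exact Prod.ext rfl (map_zero _)
  · exact hw

variable [IsUniformAddGroup F] [ContinuousSMul ℂ F] [CompleteSpace F] [T2Space F]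
  [(uniformity F).IsCountablyGenerated]

/-- The component containing `dr` of the exterior derivative of a form without radial part
is the derivative of the form in the direction of `r`, up to a sign. -/
theorem extD_withRadial (hθ : θ ∈ A.forms n M k) (h : HasNoRadialPart θ) (r : HalfLine) (p : M)
    (v : Fin k → EuclideanSpace ℝ (Fin n)) :
    extD (coneModel n) θ (r, p) (withRadial v)
      = A.incl ((-1) ^ k • A.derivative
        (A.coeff θ p (fun i ↦ (0, v i)) (extChartAt (𝓡 n) p p))) r := by
  have ho := isOpen_extChartAt_target (I := 𝓡 n) p
  have hx := mem_extChartAt_target (I := 𝓡 n) p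
  choose g' hg' using fun i ↦ (isSmoothOn_coeff hθ p
    (i.removeNth (withRadial v))).exists_isDirDeriv ho (withRadial v i).2
  -- `∂_r` has no component along the base.
  have hlast : g' (Fin.last k) (extChartAt (𝓡 n) p p) = 0 := by
    have h1 := (hg' (Fin.last k)).1 _ hx
    rw [withRadial_last] at h1
    exact tendsto_nhds_unique h1 (by simp)
  -- Removing a vector tangent to the base leaves a tuple containing `∂_r`, on which `θ` vanishes.
  have hcast : ∀ i : Fin k, g' i.castSucc (extChartAt (𝓡 n) p p) = 0 := fun i ↦ by
    obtain ⟨j, hj⟩ := Fin.exists_succAbove_eq (Fin.castSucc_lt_last i).ne'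
    have h0 : MapsTo (A.coeff θ p (i.castSucc.removeNth (withRadial v)))
        (extChartAt (𝓡 n) p).target ((⊥ : Submodule ℝ F) : Set F) := fun x hx ↦ by
      refine coeff_eq_zero_of_hasNoRadialPart h (i := j) ?_ (fun l hl ↦ ?_) hx
      · rw [Fin.removeNth, hj, withRadial_last]
      · rw [Fin.removeNth]
        rcases Fin.eq_castSucc_or_eq_last (i.castSucc.succAbove l) with ⟨m, hm⟩ | hm
        · rw [hm, withRadial_castSucc]
        · exact absurd (Fin.succAbove_right_injective (hm.trans hj.symm)) hl
    exact (hg' i.castSucc).1.mem ho (S := ⊥) isClosed_singleton h0 hx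
  rw [← localRep_cone_self _ _ r, localRep_extD_cone hθ (r, p) _ (fun i ↦ (hg' i).1) hx,
    Fin.sum_univ_castSucc]
  simp only [hcast, hlast, withRadial_castSucc, withRadial_last, zero_smul, add_zero, smul_zero,
    Finset.sum_const_zero, zero_add, one_smul, Fin.val_last, removeNth_last_withRadial]

/-- A closed form in `Ω^k 𝒜₀` without radial part does not depend on `r`, so it vanishes. -/
theorem eq_zero_of_hasNoRadialPart (hθ : θ ∈ A.forms n M k) (hd : extD (coneModel n) θ = 0)
    (h : HasNoRadialPart θ) : θ = 0 := by
  funext ⟨r, p⟩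
  refine ContinuousAlternatingMap.toAlternatingMap_injective
    (alternatingMap_eq_zero_of_prod (V := EuclideanSpace ℝ (Fin n))
      (show (ℝ × EuclideanSpace ℝ (Fin n)) [⋀^Fin k]→L[ℝ] ℂ from θ (r, p)).toAlternatingMap
      (fun v ↦ ?_) (h r p))
  obtain ⟨ε, hε, hv⟩ := exists_coeff_mem_vanishing hθ
  have hx := mem_extChartAt_target (I := 𝓡 n) p
  have hD : (-1) ^ k • A.derivative
      (A.coeff θ p (fun i ↦ (0, v i)) (extChartAt (𝓡 n) p p)) = 0 := by
    refine A.incl_injective (funext fun r ↦ ?_)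
    rw [← extD_withRadial hθ h r p v, hd, map_zero]
    rfl
  have hc := eq_zero_of_derivative_eq_zero hε (hv p _ hx) (by
    simpa [smul_smul, ← mul_pow] using congrArg (fun a ↦ (-1 : ℤ) ^ k • a) hD)
  change θ (r, p) _ = 0
  rw [← localRep_cone_self θ r ⟨0, Set.self_mem_Ici⟩, ← incl_coeff hθ _ hx, hc]
  simp

end CoefficientSpace

/-! ### Construction of forms on the cone -/

namespace CoefficientSpace

section Construction

variable {n : ℕ} {M : Type*} [TopologicalSpace M] [ChartedSpace (EuclideanSpace ℝ (Fin n)) M]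
  {F : Type*} [AddCommGroup F] [Module ℂ F] {k : ℕ}

/-- The form on the cone with values `θ_{(r,p)}(w) = β_p(w)(r)`, for alternating maps `β_p` with
values in `𝒜`. -/
def formOfAlternating [TopologicalSpace F] (A : CoefficientSpace F)
    (β : M → (ℝ × EuclideanSpace ℝ (Fin n)) [⋀^Fin k]→ₗ[ℝ] F) :
    FormField (coneModel n) (HalfLine × M) k := fun q ↦
  let f : (ℝ × EuclideanSpace ℝ (Fin n)) [⋀^Fin k]→ₗ[ℝ] ℂ :=
    ((LinearMap.proj q.1 ∘ₗ A.incl).restrictScalars ℝ).compAlternatingMap (β q.2)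
  { f with cont := continuous_alternatingMap f }

theorem formOfAlternating_apply [TopologicalSpace F] (A : CoefficientSpace F)
    (β : M → (ℝ × EuclideanSpace ℝ (Fin n)) [⋀^Fin k]→ₗ[ℝ] F) (r : HalfLine) (p : M)
    (w : Fin k → ℝ × EuclideanSpace ℝ (Fin n)) :
    A.formOfAlternating β (r, p) w = A.incl (β p w) r :=
  rfl

variable [IsManifold (𝓡 n) ∞ M]

/-- The map `β` of `formOfAlternating` in the chart at `p₀`. -/
def alternatingRep (β : M → (ℝ × EuclideanSpace ℝ (Fin n)) [⋀^Fin k]→ₗ[ℝ] F) (p₀ : M)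
    (w : Fin k → ℝ × EuclideanSpace ℝ (Fin n)) (x : EuclideanSpace ℝ (Fin n)) : F :=
  β ((extChartAt (𝓡 n) p₀).symm x) fun i ↦
    ((w i).1, mfderivWithin 𝓘(ℝ, EuclideanSpace ℝ (Fin n)) (𝓡 n)
      (extChartAt (𝓡 n) p₀).symm (range (𝓡 n)) x (w i).2)

theorem localRep_formOfAlternating [TopologicalSpace F] (A : CoefficientSpace F)
    (β : M → (ℝ × EuclideanSpace ℝ (Fin n)) [⋀^Fin k]→ₗ[ℝ] F) {p₀ : M}
    (w : Fin k → ℝ × EuclideanSpace ℝ (Fin n)) {x : EuclideanSpace ℝ (Fin n)}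
    (hx : x ∈ (extChartAt (𝓡 n) p₀).target) (r : HalfLine) :
    A.incl (alternatingRep β p₀ w x) r = localRep (coneModel n) (A.formOfAlternating β)
      (⟨0, Set.self_mem_Ici⟩, p₀) ((r : ℝ), x) w :=
  (localRep_cone_apply (A.formOfAlternating β) (_, p₀) r hx w).symm

variable [UniformSpace F] (A : CoefficientSpace F)

/-- The component `θ_{(·,p)}(v₁, …, v_k, ∂_r)` of a form in `Ω^{k+1} 𝒜₀` containing `dr`, as an
alternating map with values in `𝒜`. -/
def radialPart [IsUniformAddGroup F] [ContinuousSMul ℂ F] (θ : A.forms n M (k + 1)) (p : M) :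
    (EuclideanSpace ℝ (Fin n)) [⋀^Fin k]→ₗ[ℝ] F :=
  let φ : HalfLine → (EuclideanSpace ℝ (Fin n)) [⋀^Fin k]→ₗ[ℝ] ℂ := fun r ↦
    insertLast (show (ℝ × EuclideanSpace ℝ (Fin n)) [⋀^Fin (k + 1)]→L[ℝ] ℂ from
      θ.1 (r, p)).toAlternatingMap
  have h := fun v : Fin k → EuclideanSpace ℝ (Fin n) ↦ (fiberCoeff_mem_range A θ p v).choose_spec
  { toFun := fun v ↦ (fiberCoeff_mem_range A θ p v).choose
    map_update_add' := fun v i x y ↦ by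
      refine A.incl_injective ((h _).trans (Eq.trans ?_ (map_add A.incl _ _).symm))
      exact (funext fun r ↦ (φ r).map_update_add v i x y).trans
        (congrArg₂ (· + ·) (h _) (h _)).symm
    map_update_smul' := fun v i c x ↦ by
      refine A.incl_injective ((h _).trans (Eq.trans ?_
        ((A.incl.restrictScalars ℝ).map_smul c _).symm))
      exact (funext fun r ↦ (φ r).map_update_smul v i c x).trans
        (congrArg (c • ·) (h _)).symm
    map_eq_zero_of_eq' := fun v i j hv hij ↦ by
      refine A.incl_injective ((h _).trans (Eq.trans ?_ (map_zero A.incl).symm))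
      exact funext fun r ↦ (φ r).map_eq_zero_of_eq v hv hij }

variable [IsUniformAddGroup F] [ContinuousSMul ℂ F]

theorem incl_radialPart (θ : A.forms n M (k + 1)) (p : M)
    (v : Fin k → EuclideanSpace ℝ (Fin n)) : A.incl (A.radialPart θ p v) = fiberCoeff θ.1 p v :=
  (fiberCoeff_mem_range A θ p v).choose_spec

theorem fiberIntegral_apply (θ : A.forms n M (k + 1)) (p : M)
    (v : Fin k → EuclideanSpace ℝ (Fin n)) :
    A.fiberIntegral M k θ p v = A.reg (A.radialPart θ p v) :=
  A.integral_eq _ (A.incl_radialPart θ p v)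

theorem radialPart_chart (θ : A.forms n M (k + 1)) {p₀ : M} {x : EuclideanSpace ℝ (Fin n)}
    (hx : x ∈ (extChartAt (𝓡 n) p₀).target) (v : Fin k → EuclideanSpace ℝ (Fin n)) :
    A.radialPart θ ((extChartAt (𝓡 n) p₀).symm x) (fun i ↦
      mfderivWithin 𝓘(ℝ, EuclideanSpace ℝ (Fin n)) (𝓡 n)
        (extChartAt (𝓡 n) p₀).symm (range (𝓡 n)) x (v i)) = A.coeff θ.1 p₀ (withRadial v) x := by
  refine A.incl_injective (funext fun r ↦ ?_)
  rw [incl_coeff θ.2 _ hx]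
  exact (congrFun (A.incl_radialPart θ _ _) r).trans (localRep_withRadial θ.1 (_, p₀) r hx v).symm

theorem fiberIntegral_eq_zero_of_hasNoRadialPart (θ : A.forms n M (k + 1))
    (h : HasNoRadialPart θ.1) : A.fiberIntegral M k θ = 0 := by
  funext p
  suffices h0 : ∀ v : Fin k → EuclideanSpace ℝ (Fin n),
      A.fiberIntegral M k θ p v = 0 from ContinuousAlternatingMap.ext h0
  intro v
  have h1 : A.radialPart θ p v = 0 := by
    refine A.incl_injective (funext fun r ↦ ?_)
    rw [incl_radialPart, map_zero]
    refine h r p _ (Fin.last k) (withRadial_last v) fun j hj ↦ ?_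
    obtain ⟨i, rfl⟩ := Fin.exists_castSucc_eq.2 hj
    exact congrArg Prod.fst (withRadial_castSucc v i)
  rw [fiberIntegral_apply, h1, map_zero]

variable [CompleteSpace F] [T2Space F] [(uniformity F).IsCountablyGenerated]

theorem formOfAlternating_mem_forms {β : M → (ℝ × EuclideanSpace ℝ (Fin n)) [⋀^Fin k]→ₗ[ℝ] F}
    {ε : ℝ} (hε : 0 < ε) (hβ : ∀ p w, β p w ∈ A.vanishing ε)
    (hs : ∀ p₀ w, IsSmoothOn (extChartAt (𝓡 n) p₀).target (alternatingRep β p₀ w)) :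
    A.formOfAlternating β ∈ A.forms n M k := by
  refine mem_forms ⟨ε, hε, fun r p hr ↦ ?_⟩ fun p₀ w ↦
    ⟨_, hs p₀ w, fun x hx r ↦ A.localRep_formOfAlternating β w hx r⟩
  suffices h0 : ∀ w : Fin k → ℝ × EuclideanSpace ℝ (Fin n),
      A.formOfAlternating β (r, p) w = 0 from ContinuousAlternatingMap.ext h0
  exact fun w ↦ hβ p w r hr

/-! ### Surjectivity of the integration along the fiber -/

/-- The alternating map `η ∧ dr` on `ℝ × V`, for an alternating map `η` on `V`. It is encoded as
`(-1)^k dr ∧ η`. -/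
def wedgeRadial {V : Type*} [AddCommGroup V] [Module ℝ V] (η : V [⋀^Fin k]→ₗ[ℝ] ℂ) :
    (ℝ × V) [⋀^Fin (k + 1)]→ₗ[ℝ] ℂ :=
  (-1 : ℝ) ^ k • AlternatingMap.alternatizeUncurryFin
    ((LinearMap.fst ℝ ℝ V).smulRight (η.compLinearMap (LinearMap.snd ℝ ℝ V)))

theorem wedgeRadial_apply {V : Type*} [AddCommGroup V] [Module ℝ V] (η : V [⋀^Fin k]→ₗ[ℝ] ℂ)
    (w : Fin (k + 1) → ℝ × V) : wedgeRadial η w = (-1 : ℝ) ^ k • ∑ i : Fin (k + 1),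
      (-1) ^ (i : ℕ) • (w i).1 • η fun j ↦ (i.removeNth w j).2 := by
  rw [wedgeRadial, AlternatingMap.smul_apply, AlternatingMap.alternatizeUncurryFin_apply]
  rfl

theorem wedgeRadial_withRadial {V : Type*} [AddCommGroup V] [Module ℝ V]
    (η : V [⋀^Fin k]→ₗ[ℝ] ℂ) (v : Fin k → V) : wedgeRadial η (withRadial v) = η v := by
  rw [wedgeRadial_apply, Fin.sum_univ_castSucc]
  simp only [withRadial_castSucc, zero_smul, smul_zero, Finset.sum_const_zero, zero_add,
    withRadial_last, one_smul, removeNth_last_withRadial, Fin.val_last]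
  rcases neg_one_pow_eq_or ℤ k with h | h <;> rcases Nat.even_or_odd k with h' | h' <;>
    simp [h'.neg_one_pow]

/-- Every smooth form `η` on the base is the integral along the fiber of a form `f η ∧ dr`,
where `f ∈ 𝒜₀` has regularized integral `1`. -/
theorem exists_fiberIntegral_eq {η : FormField (𝓡 n) M k} (hη : η ∈ smoothForms (𝓡 n) M k) :
    ∃ θ : A.forms n M (k + 1), A.fiberIntegral M k θ = η := by
  have : ContinuousSMul ℝ F := IsScalarTower.continuousSMul ℂ
  obtain ⟨a, ha, hreg⟩ := A.exists_reg_eq_one one_pos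
  let L : ℂ →ₗ[ℝ] F := (LinearMap.toSpanSingleton ℂ F a).restrictScalars ℝ
  have hL : ∀ c, L c = c • a := fun c ↦ rfl
  let β : M → (ℝ × EuclideanSpace ℝ (Fin n)) [⋀^Fin (k + 1)]→ₗ[ℝ] F := fun p ↦
    L.compAlternatingMap (wedgeRadial
      (show (EuclideanSpace ℝ (Fin n)) [⋀^Fin k]→L[ℝ] ℂ from η p).toAlternatingMap)
  have hβ : A.formOfAlternating β ∈ A.forms n M (k + 1) := by
    refine A.formOfAlternating_mem_forms one_pos (fun p w ↦ Submodule.smul_mem _ _ ha)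
      fun p₀ w ↦ ?_
    have ho := isOpen_extChartAt_target (I := 𝓡 n) p₀
    have h1 : ContDiffOn ℝ ∞ (fun x ↦ (-1 : ℝ) ^ k • ∑ i : Fin (k + 1),
        (-1) ^ (i : ℕ) • (w i).1 • localRep (𝓡 n) η p₀ x fun j ↦ (i.removeNth w j).2)
        (extChartAt (𝓡 n) p₀).target := by
      refine ContDiffOn.const_smul _ (ContDiffOn.sum fun i _ ↦ ?_)
      have h2 : ContDiffOn ℝ ∞ (fun x ↦ localRep (𝓡 n) η p₀ x fun j ↦ (i.removeNth w j).2)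
          (extChartAt (𝓡 n) p₀).target :=
        (ContinuousAlternatingMap.apply ℝ (EuclideanSpace ℝ (Fin n)) ℂ
          fun j ↦ (i.removeNth w j).2).contDiff.comp_contDiffOn (hη p₀)
      have h3 := (contDiffOn_const (c := (w i).1)).smul h2
      rcases neg_one_pow_eq_or ℤ (i : ℕ) with h | h <;> rw [h]
      · simpa using! h3
      · simpa using! h3.neg
    refine (isSmoothOn_of_contDiffOn ho h1).map ho (S := ⊤) isClosed_univ (L := L) ?_
      (mapsTo_univ _ _) |>.congr ho fun x _ ↦ ?_
    · refine Continuous.continuousOn ?_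
      exact continuous_id.smul continuous_const
    · exact congrArg L (wedgeRadial_apply _ _)
  refine ⟨⟨_, hβ⟩, ?_⟩
  funext p
  suffices h0 : ∀ v : Fin k → EuclideanSpace ℝ (Fin n),
      A.fiberIntegral M k ⟨_, hβ⟩ p v = η p v from ContinuousAlternatingMap.ext h0
  intro v
  have h1 : A.radialPart ⟨_, hβ⟩ p v = L (η p v) := by
    refine A.incl_injective (funext fun r ↦ ?_)
    rw [incl_radialPart]
    exact congrArg (fun c ↦ A.incl (L c) r) (wedgeRadial_withRadial _ v)
  rw [fiberIntegral_apply, h1, hL, map_smul, hreg, smul_eq_mul, mul_one]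

/-! ### The kernel of the integration along the fiber is acyclic -/

/-- A closed form with vanishing integral along the fiber is the differential of a form without
radial part: integrate the component containing `dr` in the direction of `r`. -/
theorem exists_extD_eq_of_fiberIntegral_eq_zero (θ : A.forms n M (k + 1))
    (hd : extD (coneModel n) θ.1 = 0) (hint : A.fiberIntegral M k θ = 0) :
    ∃ γ ∈ A.forms n M k, HasNoRadialPart γ ∧ extD (coneModel n) γ = θ.1 := by
  obtain ⟨ε, hε, hv⟩ := exists_coeff_mem_vanishing θ.2
  obtain ⟨-, P, hPc, hP⟩ := A.exists_primitive hε
  have hradial : ∀ p v, A.radialPart θ p v = A.coeff θ.1 p (withRadial v) (extChartAt (𝓡 n) p p) :=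
    fun p v ↦ A.incl_injective <| funext fun r ↦ by
      rw [incl_radialPart, incl_coeff θ.2 _ (mem_extChartAt_target p), localRep_cone_self]
      rfl
  have hmem : ∀ p v, A.radialPart θ p v ∈ A.vanishing ε := fun p v ↦ by
    rw [hradial]
    exact hv _ _ (mem_extChartAt_target p)
  have hreg : ∀ p v, A.reg (A.radialPart θ p v) = 0 := fun p v ↦ by
    rw [← fiberIntegral_apply, hint]
    rfl
  -- The sign moves `∂_r` past `k` arguments: the component of `dγ` containing `dr` is
  -- `(-1)^k ∂_r γ`.
  let L : F →ₗ[ℝ] F := ((-1 : ℂ) ^ k • P).restrictScalars ℝ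
  let β : M → (ℝ × EuclideanSpace ℝ (Fin n)) [⋀^Fin k]→ₗ[ℝ] F := fun p ↦
    L.compAlternatingMap ((A.radialPart θ p).compLinearMap (LinearMap.snd ℝ ℝ _))
  have hβ : ∀ p w, β p w = (-1 : ℂ) ^ k • P (A.radialPart θ p fun i ↦ (w i).2) := fun p w ↦ rfl
  have hγ : A.formOfAlternating β ∈ A.forms n M k := by
    refine A.formOfAlternating_mem_forms hε
      (fun p w ↦ Submodule.smul_mem _ _ (hP _ (hmem p _)).1) fun p₀ w ↦ ?_
    have ho := isOpen_extChartAt_target (I := 𝓡 n) p₀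
    refine ((isSmoothOn_coeff θ.2 p₀ (withRadial fun i ↦ (w i).2)).map ho
      (S := (A.vanishing ε).restrictScalars ℝ) (A.isClosed_vanishing ε) (L := L)
      (hPc.const_smul _) (hv _ _)).congr ho fun x hx ↦ ?_
    exact congrArg L (A.radialPart_chart θ hx fun i ↦ (w i).2)
  have hγr : HasNoRadialPart (A.formOfAlternating β) := fun r p w i hi _ ↦ by
    rw [formOfAlternating_apply, hβ,
      (A.radialPart θ p).map_coord_zero i (by rw [hi] : (w i).2 = 0), map_zero, smul_zero,
      map_zero, Pi.zero_apply]
  refine ⟨_, hγ, hγr, ?_⟩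
  have hdγ := extD_mem_forms hγ
  have hc : ∀ p v, A.coeff (A.formOfAlternating β) p (fun i ↦ (0, v i)) (extChartAt (𝓡 n) p p)
      = (-1 : ℂ) ^ k • P (A.radialPart θ p v) := fun p v ↦ by
    refine coeff_eq fun r ↦ ?_
    rw [localRep_cone_self]
    rfl
  refine (sub_eq_zero.1 (eq_zero_of_hasNoRadialPart (Submodule.sub_mem _ θ.2 hdγ) ?_ ?_)).symm
  · rw [extD_sub θ.2.1 hdγ.1, hd, extD_extD hγ.1, sub_zero]
  · refine hasNoRadialPart_of_withRadial fun r p v ↦ ?_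
    have h1 := extD_withRadial hγ hγr r p v
    rw [hc, A.derivative.map_smul, (hP _ (hmem p v)).2 (hreg p v),
      ← Int.cast_smul_eq_zsmul ℂ, smul_smul, Int.cast_pow, Int.cast_neg, Int.cast_one, ← mul_pow, neg_one_mul, neg_neg, one_pow,
      one_smul, incl_radialPart] at h1
    change θ.1 (r, p) (withRadial v) - extD (coneModel n) (A.formOfAlternating β) (r, p)
      (withRadial v) = 0
    rw [h1]
    exact sub_self _

end Construction

end CoefficientSpace

/-! ### The isomorphism in cohomology -/

section Cohomology

variable {E : Type*} [NormedAddCommGroup E] [NormedSpace ℝ E] {H : Type*} [TopologicalSpace H]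
  {I : ModelWithCorners ℝ E H} {M : Type*} [TopologicalSpace M] [ChartedSpace H M]
  {Ω : ∀ k, Submodule ℂ (FormField I M k)} {k : ℕ}

theorem mem_closedForms (hΩ : ∀ k, Ω k ≤ smoothForms I M k) {θ : FormField I M k} :
    θ ∈ closedForms Ω k ↔ θ ∈ Ω k ∧ extD I θ = 0 := by
  refine and_congr_right fun h ↦ ⟨?_, fun hd ↦ ⟨⟨θ, hΩ k h⟩, hd, rfl⟩⟩
  rintro ⟨η, hη, rfl⟩
  exact hη

theorem mem_exactForms_succ (hΩ : ∀ k, Ω k ≤ smoothForms I M k) {θ : FormField I M (k + 1)} :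
    θ ∈ exactForms Ω (k + 1) ↔ ∃ η ∈ Ω k, extD I η = θ := by
  constructor
  · rintro ⟨η, hη, rfl⟩
    exact ⟨η.1, hη, rfl⟩
  · rintro ⟨η, hη, rfl⟩
    exact ⟨⟨η, hΩ k hη⟩, hη, rfl⟩

end Cohomology

namespace CoefficientSpace

variable {n : ℕ} {M : Type*} [TopologicalSpace M] [ChartedSpace (EuclideanSpace ℝ (Fin n)) M]
  {F : Type*} [AddCommGroup F] [Module ℂ F] [UniformSpace F]
  [IsUniformAddGroup F] [ContinuousSMul ℂ F] (A : CoefficientSpace F)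

theorem forms_le_smoothForms (k : ℕ) :
    A.forms n M k ≤ smoothForms (coneModel n) (HalfLine × M) k :=
  fun _ h ↦ h.1

variable [IsManifold (𝓡 n) ∞ M] [CompleteSpace F] [T2Space F]
  [(uniformity F).IsCountablyGenerated] {k : ℕ}

theorem subsingleton_cohomology_zero : Subsingleton (Cohomology (A.forms n M) 0) := by
  refine Submodule.Quotient.subsingleton_iff.2 (eq_top_iff.2 fun θ _ ↦ ?_)
  obtain ⟨hθ, hd⟩ := (mem_closedForms A.forms_le_smoothForms).1 θ.2
  exact eq_zero_of_hasNoRadialPart hθ hd fun _ _ _ i ↦ i.elim0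

theorem fiberIntegral_mem_closedForms (θ : A.forms n M (k + 1))
    (hd : extD (coneModel n) θ.1 = 0) :
    A.fiberIntegral M k θ ∈ closedForms (smoothForms (𝓡 n) M) k := by
  refine (mem_closedForms fun _ ↦ le_rfl).2 ⟨A.fiberIntegral_mem_smoothForms θ, ?_⟩
  rw [← A.fiberIntegral_extD θ (extD_mem_forms θ.2)]
  have : (⟨extD (coneModel n) θ.1, extD_mem_forms θ.2⟩ : A.forms n M (k + 2)) = 0 := Subtype.ext hd
  rw [this, map_zero]

/-- Every closed form on the base is the integral along the fiber of a closed form: correct an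
arbitrary lift `σ` by a form `γ` without radial part and with `dγ = dσ`. -/
theorem exists_closed_fiberIntegral_eq {η : FormField (𝓡 n) M k}
    (hη : η ∈ smoothForms (𝓡 n) M k) (hd : extD (𝓡 n) η = 0) :
    ∃ θ : A.forms n M (k + 1), extD (coneModel n) θ.1 = 0 ∧ A.fiberIntegral M k θ = η := by
  obtain ⟨σ, hσ⟩ := A.exists_fiberIntegral_eq hη
  obtain ⟨γ, hγ, hγr, hγd⟩ := A.exists_extD_eq_of_fiberIntegral_eq_zero
    ⟨extD (coneModel n) σ.1, extD_mem_forms σ.2⟩ (extD_extD σ.2.1)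
    (by rw [fiberIntegral_extD, hσ, hd])
  refine ⟨σ - ⟨γ, hγ⟩, ?_, ?_⟩
  · refine (extD_sub σ.2.1 hγ.1).trans ?_
    rw [hγd, sub_self]
  · rw [map_sub, hσ, A.fiberIntegral_eq_zero_of_hasNoRadialPart ⟨γ, hγ⟩ hγr, sub_zero]

/-- A closed form is exact if its integral along the fiber vanishes. -/
theorem mem_exactForms_of_fiberIntegral_eq_zero (θ : A.forms n M (k + 1))
    (hd : extD (coneModel n) θ.1 = 0) (h : A.fiberIntegral M k θ = 0) :
    θ.1 ∈ exactForms (A.forms n M) (k + 1) := by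
  obtain ⟨γ, hγ, -, hγd⟩ := A.exists_extD_eq_of_fiberIntegral_eq_zero θ hd h
  exact (mem_exactForms_succ A.forms_le_smoothForms).2 ⟨γ, hγ, hγd⟩

/-- A closed form is exact if and only if its integral along the fiber is exact. -/
theorem mem_exactForms_iff (θ : A.forms n M (k + 1)) (hd : extD (coneModel n) θ.1 = 0) :
    θ.1 ∈ exactForms (A.forms n M) (k + 1)
      ↔ A.fiberIntegral M k θ ∈ exactForms (smoothForms (𝓡 n) M) k := by
  constructor
  · intro h
    obtain ⟨γ, hγ, hγd⟩ := (mem_exactForms_succ A.forms_le_smoothForms).1 h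
    have hθ : θ = ⟨extD (coneModel n) γ, extD_mem_forms hγ⟩ := Subtype.ext hγd.symm
    rcases k with _ | k
    · rw [hθ, A.fiberIntegral_extD_zero ⟨γ, hγ⟩]
      exact zero_mem _
    · rw [hθ, A.fiberIntegral_extD ⟨γ, hγ⟩]
      exact (mem_exactForms_succ fun _ ↦ le_rfl).2 ⟨_, A.fiberIntegral_mem_smoothForms _, rfl⟩
  · intro h
    rcases k with _ | k
    · exact A.mem_exactForms_of_fiberIntegral_eq_zero θ hd h
    · obtain ⟨ζ, hζ, hζd⟩ := (mem_exactForms_succ fun _ ↦ le_rfl).1 h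
      obtain ⟨σ, hσ⟩ := A.exists_fiberIntegral_eq hζ
      let τ : A.forms n M (k + 1 + 1) := ⟨extD (coneModel n) σ.1, extD_mem_forms σ.2⟩
      have hcl : extD (coneModel n) (θ - τ).1 = 0 := by
        rw [Submodule.coe_sub, extD_sub θ.2.1 τ.2.1, hd, extD_extD σ.2.1, sub_zero]
      have hint : A.fiberIntegral M (k + 1) (θ - τ) = 0 := by
        rw [map_sub, fiberIntegral_extD, hσ, hζd, sub_self]
      have h1 := A.mem_exactForms_of_fiberIntegral_eq_zero (θ - τ) hcl hint
      rw [Submodule.coe_sub] at h1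
      have h2 : τ.1 ∈ exactForms (A.forms n M) (k + 1 + 1) :=
        (mem_exactForms_succ A.forms_le_smoothForms).2 ⟨σ.1, σ.2, rfl⟩
      have h3 := Submodule.add_mem _ h1 h2
      rwa [sub_add_cancel] at h3

/-- The isomorphism induced by the integration along the fiber. -/
theorem exists_cohomology_equiv (k : ℕ) :
    ∃ Φ : Cohomology (A.forms n M) (k + 1) ≃ₗ[ℂ] Cohomology (smoothForms (𝓡 n) M) k,
      ∀ (θ : FormField (coneModel n) (HalfLine × M) (k + 1))
        (hθ : θ ∈ closedForms (A.forms n M) (k + 1)),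
        ∃ hη : A.fiberIntegral M k ⟨θ, hθ.1⟩ ∈ closedForms (smoothForms (𝓡 n) M) k,
          Φ (Submodule.Quotient.mk ⟨θ, hθ⟩)
            = Submodule.Quotient.mk ⟨A.fiberIntegral M k ⟨θ, hθ.1⟩, hη⟩ := by
  have hcl : ∀ θ : closedForms (A.forms n M) (k + 1), extD (coneModel n) θ.1 = 0 := fun θ ↦
    ((mem_closedForms A.forms_le_smoothForms).1 θ.2).2
  have hη : ∀ θ : closedForms (A.forms n M) (k + 1),
      A.fiberIntegral M k ⟨θ.1, θ.2.1⟩ ∈ closedForms (smoothForms (𝓡 n) M) k := fun θ ↦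
    A.fiberIntegral_mem_closedForms ⟨θ.1, θ.2.1⟩ (hcl θ)
  let π : closedForms (A.forms n M) (k + 1) →ₗ[ℂ] closedForms (smoothForms (𝓡 n) M) k :=
    (A.fiberIntegral M k ∘ₗ Submodule.inclusion inf_le_left).codRestrict _ hη
  let Ψ := ((exactForms (smoothForms (𝓡 n) M) k).submoduleOf
    (closedForms (smoothForms (𝓡 n) M) k)).mkQ ∘ₗ π
  have hsurj : Function.Surjective Ψ := by
    refine (Submodule.mkQ_surjective _).comp fun η ↦ ?_
    obtain ⟨hηs, hηd⟩ := (mem_closedForms fun _ ↦ le_rfl).1 η.2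
    obtain ⟨θ, hd, hθ⟩ := A.exists_closed_fiberIntegral_eq hηs hηd
    exact ⟨⟨θ.1, (mem_closedForms A.forms_le_smoothForms).2 ⟨θ.2, hd⟩⟩, Subtype.ext hθ⟩
  have hker : (exactForms (A.forms n M) (k + 1)).submoduleOf (closedForms (A.forms n M) (k + 1))
      = LinearMap.ker Ψ := by
    rw [LinearMap.ker_comp, Submodule.ker_mkQ]
    ext θ
    exact A.mem_exactForms_iff ⟨θ.1, θ.2.1⟩ (hcl θ)
  refine ⟨(Submodule.quotEquivOfEq _ _ hker).trans (Ψ.quotKerEquivOfSurjective hsurj),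
    fun θ hθ ↦ ⟨hη ⟨θ, hθ⟩, rfl⟩⟩

end CoefficientSpace
end ConeThom
end

open ConeThom in
theorem mainTheorem2 {n : ℕ} {M : Type*} [TopologicalSpace M] [T2Space M] [CompactSpace M]
    [ChartedSpace (EuclideanSpace ℝ (Fin n)) M] [IsManifold (𝓡 n) ∞ M]
    {F : Type*} [AddCommGroup F] [Module ℂ F] [UniformSpace F] [IsUniformAddGroup F]
    [ContinuousSMul ℂ F] [LocallyConvexSpace ℝ F] [CompleteSpace F] [T2Space F]
    [(uniformity F).IsCountablyGenerated] (A : CoefficientSpace F) :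
    -- the exterior derivative acts on the forms with coefficients in `𝒜₀`
    (∀ k, ∀ θ ∈ A.forms n M k, extD (coneModel n) θ ∈ A.forms n M (k + 1)) ∧
    -- integration along the fiber is a morphism of complexes (of degree `-1`)
    (∀ k (θ : A.forms n M (k + 1)), A.fiberIntegral M k θ ∈ smoothForms (𝓡 n) M k) ∧
    (∀ (θ : A.forms n M 0) (h : extD (coneModel n) θ.1 ∈ A.forms n M 1),
      A.fiberIntegral M 0 ⟨extD (coneModel n) θ.1, h⟩ = 0) ∧
    (∀ k (θ : A.forms n M (k + 1)) (h : extD (coneModel n) θ.1 ∈ A.forms n M (k + 2)),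
      A.fiberIntegral M (k + 1) ⟨extD (coneModel n) θ.1, h⟩
        = extD (𝓡 n) (A.fiberIntegral M k θ)) ∧
    -- it induces isomorphisms in cohomology
    Subsingleton (Cohomology (A.forms n M) 0) ∧
    ∀ k, ∃ Φ : Cohomology (A.forms n M) (k + 1) ≃ₗ[ℂ] Cohomology (smoothForms (𝓡 n) M) k,
      ∀ (θ : FormField (coneModel n) (HalfLine × M) (k + 1))
        (hθ : θ ∈ closedForms (A.forms n M) (k + 1)),
        ∃ hη : A.fiberIntegral M k ⟨θ, hθ.1⟩ ∈ closedForms (smoothForms (𝓡 n) M) k,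
          Φ (Submodule.Quotient.mk ⟨θ, hθ⟩)
            = Submodule.Quotient.mk ⟨A.fiberIntegral M k ⟨θ, hθ.1⟩, hη⟩ :=
  ⟨fun _ _ hθ ↦ CoefficientSpace.extD_mem_forms hθ,
    fun _ θ ↦ A.fiberIntegral_mem_smoothForms θ,
    fun θ h ↦ A.fiberIntegral_extD_zero θ h,
    fun _ θ h ↦ A.fiberIntegral_extD θ h,
    A.subsingleton_cohomology_zero,
    fun k ↦ A.exists_cohomology_equiv k⟩
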